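/- Let $\mathcal Y\subseteq\mathbb R$ be a Borel set, $G_0$ a probability measure on $\mathcal Y$, $\alpha>0$, and let $\theta=(\theta_1,\dots,\theta_n)\in\mathbb R^n$ be fixed. A completely random measure (CRM) with Lévy intensity $\nu$ on $(0,\infty)\times\mathcal Y$ is a random measure that takes independent values on disjoint measurable sets and satisfies $\mathbb E\, e^{-\int h\,d\mu}=\exp\{-\int(1-e^{-s h(y)})\,\nu(ds,dy)\}$ for all measurable $h\ge 0$. Let $\mu$ be the gamma CRM on $\mathcal Y$, with Lévy intensity $s^{-1}e^{-s}\,ds\;\alpha G_0(dz)$, and put $T_i=\int_{\mathcal Y}e^{\theta_i z}\mu(dz)$, assumed to be almost surely finite. Given $\mu$, let $z_1,\dots,z_n$ be independent with $z_i\sim T_i^{-1}e^{\theta_i z}\mu(dz)$, and let $u_i=\gamma_i/T_i$, where $\gamma_1,\dots,\gamma_n$ are independent $\mathrm{Exp}(1)$ variables, independent of $(\mu,\mathbf z)$. Write $\psi(z;\mathbf u)=\sum_{i=1}^n u_i e^{\theta_i z}$. Then there is a regular conditional distribution of $\mu$ given $\mathbf u=(u_1,\dots,u_n)$ and $\mathbf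 z=(z_1,\dots,z_n)$ such that, for every $\mathbf u\in(0,\infty)^n$ and every $\mathbf z\in\mathcal Y^n$ with distinct values $z^\star_1,\dots,z^\star_k$ of multiplicities $n^\star_1,\dots,n^\star_k$, $$\mu\mid\mathbf u,\mathbf z\ \stackrel{d}{=}\ \mu^o+\sum_{\ell=1}^k J_\ell\,\delta_{z^\star_\ell},$$ where 1. $\mu^o$ is a CRM with Lévy intensity $\nu^o(ds,dz)=s^{-1}\exp\{-s(1+\psi(z;\mathbf u))\}\,ds\;\alpha G_0(dz)$; 2. $J_\ell\sim\mathrm{Gamma}(n^\star_\ell,\ 1+\psi(z^\star_\ell;\mathbf u))$ (shape, rate), with density proportional to $s^{n^\star_\ell-1}e^{-s\{1+\psi(z^\star_\ell;\mathbf u)\}}$, for $\ell=1,\dots,k$; 3. $\mu^o,J_1,\dots,J_k$ are independent. In particular, given $\mathbf u,\mathbf z$, $\mu$ almost surely has an atom at every $z^\star_\ell$. If $G_0(\{z^\star_\ell\})=0$ for all $\ell$, then, given $\mathbf u,\mathbf z$, the restriction of $\mu$ to $\mathcal Y\setminus\{z^\star_1,\dots,z^\star_k\}$ and the masses $(\mu(\{z^\star_\ell\}))_{\ell}$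 have jointly the law of $\mu^o$ and $(J_\ell)_{\ell}$. -/

import Mathlib

open MeasureTheory ProbabilityTheory
open scoped ENNReal NNReal

/-- `expNeg x = e^{-x}` for `x ∈ [0, ∞]`, with `e^{-∞} = 0`. -/
noncomputable def expNeg (x : ℝ≥0∞) : ℝ≥0∞ :=
  if x = ∞ then 0 else ENNReal.ofReal (Real.exp (-x.toReal))

/-- `Q` is the law of a completely random measure on `E` with Lévy intensity `ν` (a measure on
`(0, ∞) × E`, regarded as a measure on `ℝ × E`): a random measure with law `Q` takes independent
values on pairwise disjoint measurable sets, and its Laplace functional has the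
Lévy–Khintchine form `𝔼 exp(-∫ h dμ) = exp(-∫ (1 - e^{-s h(y)}) ν(ds, dy))` for all measurable
`h ≥ 0`. -/
structure IsCRM {E : Type*} [MeasurableSpace E] (Q : Measure (Measure E)) (ν : Measure (ℝ × E)) :
    Prop where
  isProbabilityMeasure : IsProbabilityMeasure Q
  indep : ∀ (m : ℕ) (A : Fin m → Set E), (∀ j, MeasurableSet (A j)) →
    Pairwise (fun i j => Disjoint (A i) (A j)) →
    iIndepFun (fun j (ρ : Measure E) => ρ (A j)) Q
  laplace : ∀ h : E → ℝ≥0, Measurable h →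
    ∫⁻ ρ, expNeg (∫⁻ y, h y ∂ρ) ∂Q =
      expNeg (∫⁻ p, ENNReal.ofReal (1 - Real.exp (-(p.1 * h p.2))) ∂ν)

/-- The Lévy intensity `(e^{-s} / s) ds · α G₀(dz)` on `(0, ∞) × E` of the gamma CRM. -/
noncomputable def gammaLevy {E : Type*} [MeasurableSpace E] (α : ℝ) (G₀ : Measure E) :
    Measure (ℝ × E) :=
  ((volume.restrict (Set.Ioi (0 : ℝ))).withDensity
    (fun s => ENNReal.ofReal (Real.exp (-s) / s))).prod (ENNReal.ofReal α • G₀)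

/-- The inhomogeneous Lévy intensity `s⁻¹ exp(-s (1 + ψ(z))) ds · α G₀(dz)` on `(0, ∞) × E`. -/
noncomputable def inhomLevy {E : Type*} [MeasurableSpace E] (α : ℝ) (G₀ : Measure E) (ψ : E → ℝ) :
    Measure (ℝ × E) :=
  ((volume.restrict (Set.Ioi (0 : ℝ))).prod (ENNReal.ofReal α • G₀)).withDensity
    (fun p => ENNReal.ofReal (p.1⁻¹ * Real.exp (-(p.1 * (1 + ψ p.2)))))

/-- `T(θ, m) = ∫ e^{θ z} m(dz)`, the total mass of the tilted measure `e^{θ z} m(dz)`. -/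
noncomputable def tiltMass {Y : Set ℝ} (θ : ℝ) (m : Measure Y) : ℝ :=
  ∫ z, Real.exp (θ * (z : ℝ)) ∂m

/-- The sampling model for fixed `θ`: given the random measure `μ`, the latent variables
`z₁, …, zₙ` are independent and `zᵢ` is distributed according to the normalized exponentially
tilted measure `Gᵢ(dz) ∝ e^{θᵢ z} μ(dz)`.
`Measure.tilted` is the normalized tilted measure when `0 < ∫ e^{θᵢ z} dμ < ∞` and the zero measure
otherwise, so `joint` forces `0 < ∫ e^{θᵢ z} dμ < ∞` almost surely. -/
structure IsTiltedSample {Ω : Type*} [MeasurableSpace Ω] (P : Measure Ω) {Y : Set ℝ} {n : ℕ}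
    (θ : Fin n → ℝ) (μ : Ω → Measure Y) (z : Ω → Fin n → Y) : Prop where
  measurable : Measurable z
  joint : ∀ (A : Set (Measure Y)) (B : Fin n → Set Y), MeasurableSet A →
    (∀ i, MeasurableSet (B i)) →
    P {ω | μ ω ∈ A ∧ ∀ i, z ω i ∈ B i} =
      ∫⁻ ω in {ω | μ ω ∈ A}, ∏ i, (μ ω).tilted (fun y => θ i * (y : ℝ)) (B i) ∂P

/-- The auxiliary variables `uᵢ = γᵢ / Tᵢ`, `Tᵢ = ∫ e^{θᵢ z} μ(dz)`. -/
noncomputable def auxU {Ω : Type*} {Y : Set ℝ} {n : ℕ} (θ : Fin n → ℝ) (μ : Ω → Measure Y)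
    (γ : Ω → Fin n → ℝ) (ω : Ω) (i : Fin n) : ℝ :=
  γ ω i / tiltMass (θ i) (μ ω)

/-- `ψ(y; u, θ) = ∑ᵢ uᵢ e^{θᵢ y}`. -/
noncomputable def psi {Y : Set ℝ} {n : ℕ} (u θ : Fin n → ℝ) (y : Y) : ℝ :=
  ∑ i, u i * Real.exp (θ i * (y : ℝ))

/-- The multiplicity of the value `a` among `z₁, …, zₙ`. -/
noncomputable def numTies {Y : Type*} {n : ℕ} (z : Fin n → Y) (a : Y) : ℕ :=
  Set.ncard {i | z i = a}

/-!
The proof rests on a quasi-invariance property of the gamma process. Its Laplace exponent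
`α ∫ log (1 + h) dG₀` turns the factorization `1 + h + g = (1 + h) (1 + g / (1 + h))` into a sum, so
that tilting its law by `exp (-∫ h dm)` amounts, up to normalization, to replacing the random
measure `m` by `m(dy) / (1 + h(y))` (`withDensity_expNeg_eq`). Both sides are compared through
their Laplace functionals, which determine the law of a random finite measure
(`Measure.ext_of_laplaceFunctional`, by the Stone-Weierstrass theorem). With `h = ψ_u` this
constructs the process `μ°` as `μ / (1 + ψ_u)` (`isCRM_map_divOneAdd`). It also shows that the
tilting multiplies the moment measure `𝔼[m(dz₁) ⋯ m(dzₙ)]` by `∏ᵢ (1 + h(zᵢ))⁻¹`, up to the same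
normalization (`lintegral_expNeg_mul_powKernel`).

With respect to `du law(μ)(dm) m(dz₁) ⋯ m(dzₙ)`, the joint law of `(u, μ, z)` has the density
`exp (-∫ ψ_u dm) ∏ᵢ exp (θᵢ zᵢ)`, because the densities `Tᵢ exp (-uᵢ Tᵢ)` of the `uᵢ` given `μ`
cancel the normalizing constants `Tᵢ` of the tilted measures (`lintegral_auxU_sample`). Inserting a
factor `exp (-∫ g dμ)` replaces `ψ_u` by `ψ_u + g`; hence the conditional Laplace functional of `μ`
given `(u, z)` at `g` is that of `μ / (1 + ψ_u)`, times
`∏ᵢ (1 + ψ_u(zᵢ)) / (1 + ψ_u(zᵢ) + g(zᵢ))`. The product belongs to independent exponential atoms at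
the `zᵢ`, one per observation. This description, which ignores ties, defines the kernel
(`posteriorKernel`); the exponential atoms at tied observations add up to the gamma variables `J_ℓ`
(`posteriorKernel_eq_map_addAtoms`).
-/

/-! ### The function `expNeg` -/

@[simp] lemma expNeg_coe (r : ℝ≥0) : expNeg r = ENNReal.ofReal (Real.exp (-r)) := by
  simp [expNeg]

lemma expNeg_of_ne_top {x : ℝ≥0∞} (hx : x ≠ ∞) :
    expNeg x = ENNReal.ofReal (Real.exp (-x.toReal)) := by
  simp [expNeg, hx]

@[simp] lemma expNeg_top : expNeg ∞ = 0 := by simp [expNeg]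

@[simp] lemma expNeg_zero : expNeg 0 = 1 := by simp [expNeg]

lemma expNeg_add (x y : ℝ≥0∞) : expNeg (x + y) = expNeg x * expNeg y := by
  induction x
  · simp
  induction y
  · simp
  rw [← ENNReal.coe_add, expNeg_coe, expNeg_coe, expNeg_coe,
    ← ENNReal.ofReal_mul (Real.exp_pos _).le, ← Real.exp_add]
  congr 2
  push_cast
  ring

lemma expNeg_sum {ι : Type*} (s : Finset ι) (f : ι → ℝ≥0∞) :
    expNeg (∑ i ∈ s, f i) = ∏ i ∈ s, expNeg (f i) := by
  classical
  induction s using Finset.induction_on with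
  | empty => simp
  | insert a s ha ih => rw [Finset.sum_insert ha, Finset.prod_insert ha, expNeg_add, ih]

lemma expNeg_le_one (x : ℝ≥0∞) : expNeg x ≤ 1 := by
  induction x
  · simp
  · rw [expNeg_coe, ← ENNReal.ofReal_one]
    exact ENNReal.ofReal_le_ofReal (by simp)

lemma expNeg_antitone : Antitone expNeg := by
  intro x y hxy
  obtain ⟨c, rfl⟩ := exists_add_of_le hxy
  rw [expNeg_add]
  exact mul_le_of_le_one_right' (expNeg_le_one c)

lemma one_sub_ofReal_le_expNeg (r : ℝ) (hr : 0 ≤ r) :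
    1 - ENNReal.ofReal r ≤ expNeg (ENNReal.ofReal r) := by
  rw [expNeg_of_ne_top ENNReal.ofReal_ne_top, ENNReal.toReal_ofReal hr, ← ENNReal.ofReal_one,
    ← ENNReal.ofReal_sub _ hr]
  exact ENNReal.ofReal_le_ofReal (by linarith [Real.add_one_le_exp (-r)])

lemma eq_zero_of_expNeg_eq_one {x : ℝ≥0∞} (h : expNeg x = 1) : x = 0 := by
  induction x with
  | top => simp at h
  | coe r =>
    rw [expNeg_coe, ENNReal.ofReal_eq_one, Real.exp_eq_one_iff] at h
    simpa using h

@[fun_prop] lemma measurable_expNeg : Measurable expNeg := by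
  unfold expNeg
  exact Measurable.ite (measurableSet_singleton _) measurable_const (by fun_prop)

/-! ### Uniqueness of Laplace transforms -/

/-- The function `x ↦ exp (-∑ i, t i * x i)` on `[0, ∞)^ι`, as a bounded continuous function. -/
noncomputable def laplaceChar {ι : Type*} [Fintype ι] (t : ι → ℝ≥0) :
    BoundedContinuousFunction (ι → ℝ≥0) ℝ :=
  BoundedContinuousFunction.ofNormedAddCommGroup
    (fun x => Real.exp (-∑ i, (t i : ℝ) * x i)) (by fun_prop) 1 (fun x => by
      rw [Real.norm_eq_abs, abs_of_pos (Real.exp_pos _)]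
      exact Real.exp_le_one_iff.2 (neg_nonpos.2 (Finset.sum_nonneg fun i _ => by positivity)))

lemma laplaceChar_apply {ι : Type*} [Fintype ι] (t x : ι → ℝ≥0) :
    laplaceChar t x = Real.exp (-∑ i, (t i : ℝ) * x i) := rfl

/-- The exponentials `x ↦ exp (-∑ i, t i * x i)` form a monoid under multiplication, so that the
algebra they generate is their linear span. -/
noncomputable def laplaceCharSubmonoid (ι : Type*) [Fintype ι] :
    Submonoid (BoundedContinuousFunction (ι → ℝ≥0) ℝ) where
  carrier := Set.range laplaceChar
  one_mem' := ⟨0, by ext x; simp [laplaceChar_apply]⟩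
  mul_mem' := by
    rintro _ _ ⟨s, rfl⟩ ⟨t, rfl⟩
    refine ⟨s + t, ?_⟩
    ext x
    simp only [laplaceChar_apply, BoundedContinuousFunction.mul_apply, ← Real.exp_add,
      Pi.add_apply, NNReal.coe_add, add_mul, Finset.sum_add_distrib]
    congr 1
    ring

/-- A finite measure on `[0, ∞)^ι` is determined by its Laplace transform. -/
theorem MeasureTheory.Measure.ext_of_laplace_pi {ι : Type*} [Fintype ι]
    {P P' : Measure (ι → ℝ≥0)} [IsFiniteMeasure P] [IsFiniteMeasure P']
    (h : ∀ t : ι → ℝ≥0, ∫⁻ x, ENNReal.ofReal (Real.exp (-∑ i, (t i : ℝ) * x i)) ∂P =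
      ∫⁻ x, ENNReal.ofReal (Real.exp (-∑ i, (t i : ℝ) * x i)) ∂P') : P = P' := by
  let A : StarSubalgebra ℝ (BoundedContinuousFunction (ι → ℝ≥0) ℝ) :=
    { Algebra.adjoin ℝ (laplaceCharSubmonoid ι : Set _) with
      star_mem' := fun {a} ha => by
        have : star a = a := by ext x; simp
        rwa [this] }
  refine ext_of_forall_mem_subalgebra_integral_eq_of_polish (𝕜 := ℝ) (A := A) ?_ ?_
  · intro x y hxy
    obtain ⟨i, hi⟩ := Function.ne_iff.1 hxy
    classical
    refine ⟨_, ⟨(laplaceChar (Pi.single i 1)).toContinuousMap,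
      ⟨laplaceChar (Pi.single i 1), Algebra.subset_adjoin ⟨_, rfl⟩, rfl⟩, rfl⟩, ?_⟩
    change laplaceChar _ x ≠ laplaceChar _ y
    rw [laplaceChar_apply, laplaceChar_apply, Ne, Real.exp_eq_exp]
    have (x : ι → ℝ≥0) : ∑ j, ((Pi.single i 1 : ι → ℝ≥0) j : ℝ) * x j = x i := by
      rw [Finset.sum_eq_single i] <;> simp +contextual
    rw [this, this, neg_inj]
    exact_mod_cast hi
  · intro g hg
    have hg' : g ∈ Submodule.span ℝ (laplaceCharSubmonoid ι : Set _) := by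
      have : g ∈ Subalgebra.toSubmodule (Algebra.adjoin ℝ (laplaceCharSubmonoid ι : Set _)) := hg
      rwa [Algebra.adjoin_eq_span, Submonoid.closure_eq] at this
    clear hg
    induction hg' using Submodule.span_induction with
    | mem g hg =>
      obtain ⟨t, rfl⟩ := hg
      rw [integral_eq_lintegral_of_nonneg_ae, integral_eq_lintegral_of_nonneg_ae]
      · exact congrArg _ (h t)
      · exact ae_of_all _ fun x => (Real.exp_pos _).le
      · exact (laplaceChar t).continuous.aestronglyMeasurable
      · exact ae_of_all _ fun x => (Real.exp_pos _).le
      · exact (laplaceChar t).continuous.aestronglyMeasurable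
    | zero => simp
    | add f g _ _ hf hg =>
      simp only [BoundedContinuousFunction.coe_add, Pi.add_apply]
      rw [integral_add (f.integrable _) (g.integrable _),
        integral_add (f.integrable _) (g.integrable _), hf, hg]
    | smul c f _ hf =>
      simp only [BoundedContinuousFunction.coe_smul, integral_smul, hf]

lemma lintegral_coe_sum_indicator {E ι : Type*} [MeasurableSpace E] (s : Finset ι) (A : ι → Set E)
    (hA : ∀ i, MeasurableSet (A i)) (t : ι → ℝ≥0) (m : Measure E) :
    ∫⁻ y, ((∑ i ∈ s, (A i).indicator (fun _ => t i) y : ℝ≥0) : ℝ≥0∞) ∂m =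
      ∑ i ∈ s, (t i : ℝ≥0∞) * m (A i) := by
  simp only [ENNReal.ofNNReal_finsetSum]
  rw [lintegral_finsetSum _ fun i _ => (measurable_const.indicator (hA i)).coe_nnreal_ennreal]
  refine Finset.sum_congr rfl fun i _ => ?_
  simp only [ENNReal.coe_indicator]
  rw [lintegral_indicator_const (hA i)]

/-- The Laplace functional of a random finite measure, evaluated at a step function, is the Laplace
transform of the vector of masses. -/
lemma lintegral_expNeg_sum_indicator {E ι : Type*} [MeasurableSpace E] [Fintype ι]
    {Q : Measure (Measure E)} (hQ : ∀ᵐ m ∂Q, IsFiniteMeasure m) (A : ι → Set E)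
    (hA : ∀ i, MeasurableSet (A i)) (t : ι → ℝ≥0) :
    ∫⁻ m, expNeg (∫⁻ y, ((∑ i, (A i).indicator (fun _ => t i) y : ℝ≥0) : ℝ≥0∞) ∂m) ∂Q =
      ∫⁻ x, ENNReal.ofReal (Real.exp (-∑ i, (t i : ℝ) * x i))
        ∂(Q.map fun m i => (m (A i)).toNNReal) := by
  have hm : Measurable fun (m : Measure E) i => (m (A i)).toNNReal :=
    measurable_pi_lambda _ fun i => (Measure.measurable_coe (hA i)).ennreal_toNNReal
  rw [lintegral_map (by fun_prop) hm]
  refine lintegral_congr_ae ?_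
  filter_upwards [hQ] with m hm
  rw [lintegral_coe_sum_indicator _ _ hA,
    expNeg_of_ne_top (ENNReal.sum_ne_top.2 fun i _ => by finiteness),
    ENNReal.toReal_sum (fun i _ => by finiteness)]
  simp [ENNReal.toReal_mul, ENNReal.coe_toNNReal_eq_toReal]

/-- The law of a random finite measure is determined by its Laplace functional. -/
theorem MeasureTheory.Measure.ext_of_laplaceFunctional {E : Type*} [MeasurableSpace E]
    {Q Q' : Measure (Measure E)} [IsFiniteMeasure Q] [IsFiniteMeasure Q']
    (hQ : ∀ᵐ m ∂Q, IsFiniteMeasure m) (hQ' : ∀ᵐ m ∂Q', IsFiniteMeasure m)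
    (h : ∀ f : E → ℝ≥0, Measurable f →
      ∫⁻ m, expNeg (∫⁻ y, f y ∂m) ∂Q = ∫⁻ m, expNeg (∫⁻ y, f y ∂m) ∂Q') : Q = Q' := by
  let ms : {s : Set E // MeasurableSet s} → MeasurableSpace (Measure E) :=
    fun s => (borel ℝ≥0∞).comap fun m => m s
  have hgen : (Measure.instMeasurableSpace : MeasurableSpace (Measure E)) =
      MeasurableSpace.generateFrom
        (piiUnionInter (fun n => {s | MeasurableSet[ms n] s}) Set.univ) := by
    refine Eq.trans ?_ (generateFrom_piiUnionInter_measurableSet ms Set.univ).symm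
    simp only [Measure.instMeasurableSpace, Set.mem_univ, iSup_pos, ms, iSup_subtype]
  refine ext_of_generate_finite _ hgen
    (isPiSystem_piiUnionInter _ (fun n => @MeasurableSpace.isPiSystem_measurableSet _ (ms n)) _)
    ?_ ?_
  · rintro s ⟨t, -, f, hf, rfl⟩
    choose! B hB hBf using hf
    have hm : Measurable fun (m : Measure E) (i : t) => (m (i : Set E)).toNNReal :=
      measurable_pi_lambda _ fun i => (Measure.measurable_coe i.1.2).ennreal_toNNReal
    have hlaw : Q.map (fun m (i : t) => (m (i : Set E)).toNNReal) =
        Q'.map (fun m (i : t) => (m (i : Set E)).toNNReal) := by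
      refine Measure.ext_of_laplace_pi fun r => ?_
      rw [← lintegral_expNeg_sum_indicator hQ (fun i : t => (i : Set E)) (fun i => i.1.2),
        ← lintegral_expNeg_sum_indicator hQ' (fun i : t => (i : Set E)) (fun i => i.1.2)]
      exact h _ (Finset.measurable_fun_sum _ fun i _ => measurable_const.indicator i.1.2)
    have key : ∀ R : Measure (Measure E), (∀ᵐ m ∂ R, IsFiniteMeasure m) →
        R (⋂ x ∈ t, f x) = R.map (fun m (i : t) => (m (i : Set E)).toNNReal)
          (Set.univ.pi fun i : t => (fun x : ℝ≥0 => (x : ℝ≥0∞)) ⁻¹' B i) := by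
      intro R hR
      rw [Measure.map_apply hm (MeasurableSet.univ_pi fun i =>
        measurable_coe_nnreal_ennreal (hB i i.2))]
      refine measure_congr ?_
      filter_upwards [hR] with m hm
      refine propext ?_
      change m ∈ ⋂ x ∈ t, f x ↔ _
      rw [Set.mem_iInter₂]
      constructor
      · intro H i
        have := H i i.2
        rw [← hBf i i.2] at this
        simpa [ENNReal.coe_toNNReal (measure_ne_top m _)] using this
      · intro H i hi
        rw [← hBf i hi]
        simpa [ENNReal.coe_toNNReal (measure_ne_top m _)] using H ⟨i, hi⟩
    rw [key Q hQ, key Q' hQ', hlaw]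
  · simpa using h 0 measurable_const

/-! ### The Laplace exponent of the gamma process -/

/-- The integral `∫₀^∞ (1 - e^{-s h}) e^{-s c} ds / s`. -/
noncomputable def frullani (c h : ℝ) : ℝ≥0∞ :=
  ∫⁻ s in Set.Ioi (0 : ℝ), ENNReal.ofReal (s⁻¹ * Real.exp (-(s * c))) *
    ENNReal.ofReal (1 - Real.exp (-(s * h)))

/-- The measure `ds / s` is invariant under dilations. -/
lemma frullani_eq_frullani_one {c : ℝ} (hc : 0 < c) (h : ℝ) :
    frullani c h = frullani 1 (h / c) := by
  have himg : (fun s : ℝ => c⁻¹ * s) '' Set.Ioi 0 = Set.Ioi 0 := by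
    rw [Set.image_mul_left_Ioi (inv_pos.2 hc), mul_zero]
  unfold frullani
  conv_lhs => rw [← himg]
  rw [lintegral_image_eq_lintegral_abs_deriv_mul measurableSet_Ioi
    (f' := fun _ => c⁻¹)
    (fun x _ => by simpa using ((hasDerivAt_id x).const_mul c⁻¹).hasDerivWithinAt)
    (mul_right_injective₀ (inv_pos.2 hc).ne').injOn]
  refine setLIntegral_congr_fun measurableSet_Ioi fun s hs => ?_
  have hs : (0 : ℝ) < s := hs
  rw [← mul_assoc, ← ENNReal.ofReal_mul (abs_nonneg _), abs_of_pos (inv_pos.2 hc)]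
  rw [show c⁻¹ * s * c = s * 1 by field_simp, show c⁻¹ * s * h = s * (h / c) by ring,
    show c⁻¹ * ((c⁻¹ * s)⁻¹ * Real.exp (-(s * 1))) = s⁻¹ * Real.exp (-(s * 1)) by field_simp]

lemma frullani_add {c h g : ℝ} (hh : 0 ≤ h) (hg : 0 ≤ g) :
    frullani c (h + g) = frullani c h + frullani (c + h) g := by
  unfold frullani
  rw [← lintegral_add_left (by fun_prop)]
  refine setLIntegral_congr_fun measurableSet_Ioi fun s hs => ?_
  have hs : (0 : ℝ) < s := hs
  have key : ∀ x : ℝ, 0 ≤ x → 0 ≤ 1 - Real.exp (-(s * x)) := fun x hx => by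
    rw [sub_nonneg, Real.exp_le_one_iff]
    nlinarith
  rw [← ENNReal.ofReal_mul (by positivity), ← ENNReal.ofReal_mul (by positivity),
    ← ENNReal.ofReal_mul (by positivity), ← ENNReal.ofReal_add
      (mul_nonneg (by positivity) (key _ hh)) (mul_nonneg (by positivity) (key _ hg))]
  congr 1
  rw [show -(s * (c + h)) = -(s * c) + -(s * h) by ring,
    show -(s * (h + g)) = -(s * h) + -(s * g) by ring, Real.exp_add, Real.exp_add]
  ring

lemma frullani_one_le {t : ℝ} (ht : 0 ≤ t) : frullani 1 t ≤ ENNReal.ofReal t := by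
  calc frullani 1 t
      ≤ ∫⁻ s in Set.Ioi (0 : ℝ), ENNReal.ofReal t * ENNReal.ofReal (Real.exp (-s)) := by
        refine setLIntegral_mono (by fun_prop) fun s hs => ?_
        have hs : (0 : ℝ) < s := hs
        rw [← ENNReal.ofReal_mul (by positivity), ← ENNReal.ofReal_mul ht]
        refine ENNReal.ofReal_le_ofReal ?_
        have : 1 - Real.exp (-(s * t)) ≤ s * t := by linarith [Real.add_one_le_exp (-(s * t))]
        calc s⁻¹ * Real.exp (-(s * 1)) * (1 - Real.exp (-(s * t)))
            ≤ s⁻¹ * Real.exp (-(s * 1)) * (s * t) := by gcongr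
          _ = t * Real.exp (-s) := by field_simp
    _ = ENNReal.ofReal t := by
        rw [lintegral_const_mul _ (by fun_prop), ← ofReal_integral_eq_lintegral_ofReal
          (integrableOn_exp_neg_Ioi 0) (ae_of_all _ fun x => (Real.exp_pos _).le),
          integral_exp_neg_Ioi_zero]
        simp

/-- The Laplace exponent `∫ (1 - e^{-s h(y)}) ν(ds, dy)` of a Lévy intensity `ν`. -/
noncomputable def levyExponent {E : Type*} [MeasurableSpace E] (ν : Measure (ℝ × E))
    (h : E → ℝ≥0) : ℝ≥0∞ :=
  ∫⁻ p, ENNReal.ofReal (1 - Real.exp (-(p.1 * h p.2))) ∂ν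

section LevyExponent

variable {E : Type*} [MeasurableSpace E] {α : ℝ} {G₀ : Measure E} [SFinite G₀]

lemma levyExponent_inhomLevy {ψ : E → ℝ} (hψ : Measurable ψ) {h : E → ℝ≥0} (hh : Measurable h) :
    levyExponent (inhomLevy α G₀ ψ) h =
      ∫⁻ y, frullani (1 + ψ y) (h y) ∂(ENNReal.ofReal α • G₀) := by
  unfold levyExponent inhomLevy frullani
  rw [lintegral_withDensity_eq_lintegral_mul _ (by fun_prop) (by fun_prop),
    lintegral_prod_symm' _ (by fun_prop)]
  rfl

lemma gammaLevy_eq_inhomLevy : gammaLevy α G₀ = inhomLevy α G₀ (fun _ => 0) := by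
  unfold gammaLevy inhomLevy
  rw [prod_withDensity_left (by fun_prop)]
  congr 1
  ext p
  simp [div_eq_inv_mul]

lemma levyExponent_gammaLevy {h : E → ℝ≥0} (hh : Measurable h) :
    levyExponent (gammaLevy α G₀) h = ∫⁻ y, frullani 1 (h y) ∂(ENNReal.ofReal α • G₀) := by
  rw [gammaLevy_eq_inhomLevy, levyExponent_inhomLevy measurable_const hh]
  simp

/-- Dividing the atoms of the gamma process by `1 + ψ` turns its Lévy intensity into the
inhomogeneous one. -/
lemma levyExponent_inhomLevy_eq_div {ψ h : E → ℝ≥0} (hψ : Measurable ψ) (hh : Measurable h) :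
    levyExponent (inhomLevy α G₀ (fun y => ψ y)) h =
      levyExponent (gammaLevy α G₀) (fun y => h y / (1 + ψ y)) := by
  rw [levyExponent_inhomLevy (by fun_prop) hh, levyExponent_gammaLevy (by fun_prop)]
  refine lintegral_congr fun y => ?_
  rw [frullani_eq_frullani_one (by positivity)]
  simp

lemma measurable_frullani {f g : E → ℝ} (hf : Measurable f) (hg : Measurable g) :
    Measurable fun y => frullani (f y) (g y) := by
  unfold frullani
  exact Measurable.lintegral_prod_right' (f := fun p : E × ℝ =>
    ENNReal.ofReal (p.2⁻¹ * Real.exp (-(p.2 * f p.1))) *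
    ENNReal.ofReal (1 - Real.exp (-(p.2 * g p.1)))) (by fun_prop)

/-- The Laplace exponent of the gamma process is `α ∫ log (1 + h) dG₀`, so that
`1 + h + g = (1 + h) (1 + g / (1 + h))` makes it additive in the following sense. -/
lemma levyExponent_gammaLevy_add {h g : E → ℝ≥0} (hh : Measurable h) (hg : Measurable g) :
    levyExponent (gammaLevy α G₀) (fun y => h y + g y) =
      levyExponent (gammaLevy α G₀) h +
        levyExponent (gammaLevy α G₀) (fun y => g y / (1 + h y)) := by
  rw [← levyExponent_inhomLevy_eq_div hh hg, levyExponent_inhomLevy (by fun_prop) hg,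
    levyExponent_gammaLevy hh, levyExponent_gammaLevy (by fun_prop),
    ← lintegral_add_left (measurable_frullani (by fun_prop) (by fun_prop))]
  refine lintegral_congr fun y => ?_
  rw [← frullani_add (by positivity) (by positivity)]
  simp

lemma levyExponent_gammaLevy_const_le [IsProbabilityMeasure G₀] (t : ℝ≥0) :
    levyExponent (gammaLevy α G₀) (fun _ => t) ≤ t * ENNReal.ofReal α := by
  rw [levyExponent_gammaLevy measurable_const]
  simp only [lintegral_const, Measure.smul_apply, measure_univ, smul_eq_mul, mul_one]
  gcongr
  simpa using frullani_one_le t.2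

end LevyExponent

lemma measurableSet_isFiniteMeasure {E : Type*} [MeasurableSpace E] :
    MeasurableSet {m : Measure E | IsFiniteMeasure m} := by
  have : {m : Measure E | IsFiniteMeasure m} = {m | m Set.univ < ∞} := by
    ext m
    exact ⟨fun h => h.1, fun h => ⟨h⟩⟩
  rw [this]
  exact Measure.measurable_coe MeasurableSet.univ measurableSet_Iio

/-- The gamma process has finite total mass: its Laplace exponent at a constant `t` vanishes
as `t → 0`. -/
lemma IsCRM.ae_isFiniteMeasure {E : Type*} [MeasurableSpace E] {Q : Measure (Measure E)}
    {α : ℝ} (hα : 0 < α) {G₀ : Measure E} [IsProbabilityMeasure G₀]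
    (hQ : IsCRM Q (gammaLevy α G₀)) : ∀ᵐ m ∂Q, IsFiniteMeasure m := by
  have := hQ.isProbabilityMeasure
  refine (mem_ae_iff_prob_eq_one measurableSet_isFiniteMeasure).2 (le_antisymm prob_le_one ?_)
  refine ENNReal.le_of_forall_pos_le_add fun ε hε _ => ?_
  -- The Laplace functional at the constant `t = ε / α` is at least `1 - ε`, and it vanishes off the
  -- finite measures.
  let t : ℝ≥0 := ε / α.toNNReal
  have ht : 0 < t := div_pos hε (by simpa using hα)
  have htα : (t : ℝ≥0∞) * ENNReal.ofReal α = ENNReal.ofReal ε := by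
    rw [ENNReal.ofReal, ENNReal.ofReal_coe_nnreal, ← ENNReal.coe_mul,
      div_mul_cancel₀ _ (by simpa using hα)]
  have hlow : 1 - ENNReal.ofReal ε ≤ ∫⁻ m, expNeg (∫⁻ _, t ∂m) ∂Q := by
    rw [hQ.laplace (fun _ => t) measurable_const]
    refine (one_sub_ofReal_le_expNeg _ ε.2).trans (expNeg_antitone ?_)
    exact (levyExponent_gammaLevy_const_le t).trans htα.le
  have hup : ∫⁻ m, expNeg (∫⁻ _, t ∂m) ∂Q ≤ Q {m | IsFiniteMeasure m} := by
    rw [← lintegral_indicator_one measurableSet_isFiniteMeasure]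
    refine lintegral_mono fun m => ?_
    by_cases hm : m ∈ {m : Measure E | IsFiniteMeasure m}
    · simpa [Set.indicator_of_mem hm] using expNeg_le_one _
    · have : m Set.univ = ∞ := by
        by_contra h
        exact hm ⟨lt_top_iff_ne_top.2 h⟩
      simp [this, ENNReal.mul_top (ENNReal.coe_ne_zero.2 ht.ne')]
  rw [ENNReal.ofReal_coe_nnreal] at hlow
  exact tsub_le_iff_right.1 (hlow.trans hup)

/-! ### Product measures -/

lemma lintegral_pi_prod {n : ℕ} {X : Fin n → Type*} [∀ i, MeasurableSpace (X i)]
    (μ : ∀ i, Measure (X i)) [∀ i, SigmaFinite (μ i)] {f : ∀ i, X i → ℝ≥0∞}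
    (hf : ∀ i, Measurable (f i)) :
    ∫⁻ x, ∏ i, f i (x i) ∂(Measure.pi μ) = ∏ i, ∫⁻ x, f i x ∂(μ i) := by
  induction n with
  | zero => simp
  | succ n ih =>
    rw [← (measurePreserving_piFinSuccAbove μ 0).symm.lintegral_comp_emb
      (MeasurableEquiv.measurableEmbedding _)]
    simp_rw [MeasurableEquiv.piFinSuccAbove_symm_apply, Fin.insertNthEquiv,
      Fin.prod_univ_succ, Fin.insertNth_zero]
    simp only [Fin.zero_succAbove]
    rw [← ih (fun i => μ i.succ) (fun i => hf i.succ), ← lintegral_prod_mul (hf 0).aemeasurable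
      (Finset.measurable_fun_prod _ fun i _ =>
        (hf i.succ).comp (measurable_pi_apply i)).aemeasurable]
    rfl

lemma pi_withDensity {n : ℕ} {X : Fin n → Type*} [∀ i, MeasurableSpace (X i)]
    (μ : ∀ i, Measure (X i)) [∀ i, SigmaFinite (μ i)] {f : ∀ i, X i → ℝ≥0∞}
    (hf : ∀ i, Measurable (f i)) [∀ i, SigmaFinite ((μ i).withDensity (f i))] :
    Measure.pi (fun i => (μ i).withDensity (f i)) =
      (Measure.pi μ).withDensity (fun x => ∏ i, f i (x i)) := by
  refine Measure.pi_eq fun s hs => ?_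
  rw [withDensity_apply _ (MeasurableSet.univ_pi hs), ← lintegral_indicator (.univ_pi hs)]
  calc _ = ∫⁻ x, ∏ i, (s i).indicator (f i) (x i) ∂(Measure.pi μ) := by
        refine lintegral_congr fun x => ?_
        by_cases hx : x ∈ Set.univ.pi s
        · rw [Set.indicator_of_mem hx]
          exact Finset.prod_congr rfl fun i _ => (Set.indicator_of_mem (hx i trivial) _).symm
        · rw [Set.indicator_of_notMem hx]
          obtain ⟨i, hi⟩ : ∃ i, x i ∉ s i := by simpa using hx
          exact (Finset.prod_eq_zero (Finset.mem_univ i) (Set.indicator_of_notMem hi _)).symm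
    _ = _ := by
        rw [lintegral_pi_prod μ fun i => (hf i).indicator (hs i)]
        exact Finset.prod_congr rfl fun i _ => by
          rw [lintegral_indicator (hs i), withDensity_apply _ (hs i)]

/-! ### Completely random measures from Laplace functionals -/

/-- The Laplace exponent is additive over functions with disjoint supports. -/
lemma levyExponent_sum_indicator {E : Type*} [MeasurableSpace E] (ν : Measure (ℝ × E)) {k : ℕ}
    {A : Fin k → Set E} (hA : ∀ j, MeasurableSet (A j))
    (hdisj : Pairwise fun i j => Disjoint (A i) (A j)) (t : Fin k → ℝ≥0) :
    levyExponent ν (fun y => ∑ j, (A j).indicator (fun _ => t j) y) =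
      ∑ j, levyExponent ν ((A j).indicator fun _ => t j) := by
  unfold levyExponent
  have hm : ∀ j, Measurable ((A j).indicator fun _ => t j) :=
    fun j => measurable_const.indicator (hA j)
  rw [← lintegral_finsetSum _ fun j _ => by have := hm j; fun_prop]
  refine lintegral_congr fun p => ?_
  by_cases hp : ∃ i, p.2 ∈ A i
  · obtain ⟨i, hi⟩ := hp
    have hout : ∀ j, j ≠ i → (A j).indicator (fun _ => t j) p.2 = 0 := fun j hj =>
      Set.indicator_of_notMem (fun h => Set.disjoint_left.1 (hdisj hj) h hi) _
    rw [Finset.sum_eq_single i (fun j _ hj => by simp [hout j hj]) (by simp)]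
    beta_reduce
    rw [Finset.sum_eq_single i (fun j _ hj => hout j hj) (by simp)]
  · push Not at hp
    simp [Set.indicator_of_notMem (hp _)]

/-- A random finite measure whose Laplace functional has the Lévy–Khintchine form takes independent
values on disjoint sets. -/
lemma isCRM_of_laplace {E : Type*} [MeasurableSpace E] {Q : Measure (Measure E)}
    [IsProbabilityMeasure Q] {ν : Measure (ℝ × E)} (hfin : ∀ᵐ m ∂Q, IsFiniteMeasure m)
    (h : ∀ h : E → ℝ≥0, Measurable h →
      ∫⁻ m, expNeg (∫⁻ y, h y ∂m) ∂Q = expNeg (levyExponent ν h)) : IsCRM Q ν where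
  isProbabilityMeasure := inferInstance
  laplace := h
  indep := by
    intro k A hA hdisj
    have hm : ∀ j, Measurable fun m : Measure E => (m (A j)).toNNReal :=
      fun j => (Measure.measurable_coe (hA j)).ennreal_toNNReal
    have hprob : ∀ j, IsProbabilityMeasure (Q.map fun m => (m (A j)).toNNReal) :=
      fun j => Measure.isProbabilityMeasure_map (hm j).aemeasurable
    have hprob' : IsProbabilityMeasure (Q.map fun m j => (m (A j)).toNNReal) :=
      Measure.isProbabilityMeasure_map (measurable_pi_lambda _ hm).aemeasurable
    have hind : iIndepFun (fun j (m : Measure E) => (m (A j)).toNNReal) Q := by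
      rw [iIndepFun_iff_map_fun_eq_pi_map fun j => (hm j).aemeasurable]
      refine Measure.ext_of_laplace_pi fun t => ?_
      have hprod : ∀ x : Fin k → ℝ≥0, ENNReal.ofReal (Real.exp (-∑ i, (t i : ℝ) * x i)) =
          ∏ i, ENNReal.ofReal (Real.exp (-((t i : ℝ) * x i))) := fun x => by
        rw [← Finset.sum_neg_distrib, Real.exp_sum,
          ENNReal.ofReal_prod_of_nonneg fun i _ => (Real.exp_pos _).le]
      rw [← lintegral_expNeg_sum_indicator hfin A hA, h _ (Finset.measurable_fun_sum _
        fun i _ => measurable_const.indicator (hA i)), levyExponent_sum_indicator ν hA hdisj,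
        expNeg_sum]
      simp_rw [hprod]
      rw [lintegral_pi_prod _ (f := fun i (x : ℝ≥0) => ENNReal.ofReal (Real.exp (-((t i : ℝ) * x))))
        fun i => by fun_prop]
      refine Finset.prod_congr rfl fun i _ => ?_
      rw [← h _ (measurable_const.indicator (hA i)), lintegral_map (by fun_prop) (hm i)]
      refine lintegral_congr_ae ?_
      filter_upwards [hfin] with m hmfin
      simp only [ENNReal.coe_indicator]
      rw [lintegral_indicator_const (hA i), expNeg_of_ne_top (by finiteness)]
      simp [ENNReal.toReal_mul, ENNReal.coe_toNNReal_eq_toReal]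
    refine (hind.comp (fun _ x => (x : ℝ≥0∞)) fun _ => measurable_coe_nnreal_ennreal).congr
      fun j => ?_
    filter_upwards [hfin] with m hmfin
    exact ENNReal.coe_toNNReal (measure_ne_top m _)

/-! ### Finite measures inside the space of all measures -/

section FinitePart

variable {E : Type*} [MeasurableSpace E]

open Classical in
/-- The measure `m` itself if it is finite, and `0` otherwise. Product measures and
integrals of parametrized functions are measurable in `m` along kernels of finite measures, but not
over all of `Measure E`; random measures that are almost surely finite are therefore passed through
this map. -/
noncomputable def finitePart (m : Measure E) : Measure E :=
  if IsFiniteMeasure m then m else 0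

instance (m : Measure E) : IsFiniteMeasure (finitePart m) := by
  unfold finitePart
  split_ifs with h
  · exact h
  · infer_instance

lemma finitePart_eq (m : Measure E) [h : IsFiniteMeasure m] : finitePart m = m := if_pos h

@[fun_prop] lemma measurable_finitePart : Measurable (finitePart : Measure E → Measure E) :=
  Measurable.ite measurableSet_isFiniteMeasure measurable_id measurable_const

/-- A kernel all of whose values are finite measures is s-finite, even if the total masses are
not uniformly bounded. -/
lemma isSFiniteKernel_of_isFiniteMeasure {X : Type*} [MeasurableSpace X] (κ : Kernel X E)
    [∀ a, IsFiniteMeasure (κ a)] : IsSFiniteKernel κ := by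
  classical
  have hs : ∀ N : ℕ, MeasurableSet {a | ⌊(κ a Set.univ).toReal⌋₊ = N} := fun N =>
    measurableSet_eq_fun
      (Nat.measurable_floor.comp (κ.measurable_coe MeasurableSet.univ).ennreal_toReal)
      measurable_const
  refine ⟨fun N => Kernel.piecewise (hs N) κ 0, fun N => ⟨⟨ENNReal.ofReal (N + 1),
    ENNReal.ofReal_lt_top, fun a => ?_⟩⟩, ?_⟩
  · rw [Kernel.piecewise_apply]
    split_ifs with h
    · rw [← ENNReal.ofReal_toReal (measure_ne_top (κ a) Set.univ)]
      have h : ⌊(κ a Set.univ).toReal⌋₊ = N := h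
      rw [← h]
      exact ENNReal.ofReal_le_ofReal (Nat.lt_floor_add_one _).le
    · simp
  · ext a s hs'
    rw [Kernel.sum_apply' _ _ hs', tsum_eq_single ⌊(κ a Set.univ).toReal⌋₊]
    · simp [Kernel.piecewise_apply]
    · intro N hN
      have : a ∉ {a | ⌊(κ a Set.univ).toReal⌋₊ = N} := fun h => hN (Eq.symm h)
      simp [Kernel.piecewise_apply, this]

/-- The map `finitePart` as a kernel. -/
noncomputable def finiteKernel (E : Type*) [MeasurableSpace E] : Kernel (Measure E) E :=
  ⟨finitePart, measurable_finitePart⟩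

lemma finiteKernel_apply (m : Measure E) : finiteKernel E m = finitePart m := rfl

instance (m : Measure E) : IsFiniteMeasure (finiteKernel E m) := by
  rw [finiteKernel_apply]
  infer_instance

instance : IsSFiniteKernel (finiteKernel E) := isSFiniteKernel_of_isFiniteMeasure _

/-- The kernel sending a finite measure `m` to its `n`-fold product `m ⊗ ⋯ ⊗ m`. -/
noncomputable def powKernel (E : Type*) [MeasurableSpace E] (n : ℕ) :
    Kernel (Measure E) (Fin n → E) where
  toFun m := Measure.pi fun _ => finitePart m
  measurable' := by
    refine Measurable.measure_of_isPiSystem generateFrom_pi.symm isPiSystem_pi ?_ ?_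
    · rintro _ ⟨s, hs, rfl⟩
      simp only [Measure.pi_pi]
      exact Finset.measurable_fun_prod _ fun i _ =>
        (Measure.measurable_coe (hs i trivial)).comp measurable_finitePart
    · simp only [Measure.pi_univ]
      exact Finset.measurable_fun_prod _ fun i _ =>
        (Measure.measurable_coe MeasurableSet.univ).comp measurable_finitePart

lemma powKernel_apply (n : ℕ) (m : Measure E) :
    powKernel E n m = Measure.pi fun _ => finitePart m := rfl

instance (n : ℕ) (m : Measure E) : IsFiniteMeasure (powKernel E n m) := by
  rw [powKernel_apply]
  infer_instance

instance (n : ℕ) : IsSFiniteKernel (powKernel E n) := isSFiniteKernel_of_isFiniteMeasure _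

/-! ### Dividing a random measure by `1 + h` -/

/-- The measure `m(dy) / (1 + h(y))`, for a finite measure `m`. -/
noncomputable def divOneAdd (h : E → ℝ≥0) (m : Measure E) : Measure E :=
  (finitePart m).withDensity fun y => ((1 + h y)⁻¹ : ℝ≥0)

instance (h : E → ℝ≥0) (m : Measure E) : IsFiniteMeasure (divOneAdd h m) := by
  refine isFiniteMeasure_withDensity
    (ne_top_of_le_ne_top (measure_ne_top (finitePart m) Set.univ) ?_)
  calc ∫⁻ y, ((1 + h y)⁻¹ : ℝ≥0) ∂(finitePart m) ≤ ∫⁻ _, 1 ∂(finitePart m) :=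
        lintegral_mono fun y => by
          rw [ENNReal.coe_le_one_iff]
          exact inv_le_one_of_one_le₀ le_self_add
    _ = _ := by simp

lemma lintegral_divOneAdd {h : E → ℝ≥0} (hh : Measurable h) (m : Measure E) {g : E → ℝ≥0}
    (hg : Measurable g) :
    ∫⁻ y, g y ∂(divOneAdd h m) = ∫⁻ y, (g y / (1 + h y) : ℝ≥0) ∂(finitePart m) := by
  rw [divOneAdd, lintegral_withDensity_eq_lintegral_mul _ (by fun_prop) (by fun_prop)]
  refine lintegral_congr fun y => ?_
  rw [Pi.mul_apply, ← ENNReal.coe_mul, div_eq_inv_mul]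

lemma measurable_divOneAdd_prod {X : Type*} [MeasurableSpace X] {h : X × E → ℝ≥0}
    (hh : Measurable h) :
    Measurable fun p : X × Measure E => divOneAdd (fun y => h (p.1, y)) p.2 := by
  refine Measure.measurable_of_measurable_coe _ fun s hs => ?_
  let K : Kernel (X × Measure E) E := (finiteKernel E).comap Prod.snd measurable_snd
  have : IsSFiniteKernel K := inferInstanceAs
    (IsSFiniteKernel ((finiteKernel E).comap Prod.snd measurable_snd))
  have : ∀ p : X × Measure E, divOneAdd (fun y => h (p.1, y)) p.2 s =
      ∫⁻ y, s.indicator (fun y => (((1 + h (p.1, y))⁻¹ : ℝ≥0) : ℝ≥0∞)) y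
        ∂(K p) := fun p => by
    rw [divOneAdd, withDensity_apply _ hs, lintegral_indicator hs, Kernel.comap_apply,
      finiteKernel_apply]
  simp_rw [this]
  refine Measurable.lintegral_kernel_prod_right
    (f := fun p : X × Measure E => s.indicator fun y => (((1 + h (p.1, y))⁻¹ : ℝ≥0) : ℝ≥0∞)) ?_
  exact Measurable.indicator (s := {q : (X × Measure E) × E | q.2 ∈ s})
    (f := fun q => (((1 + h (q.1.1, q.2))⁻¹ : ℝ≥0) : ℝ≥0∞))
    (by fun_prop) (measurable_snd hs)

lemma measurable_divOneAdd {h : E → ℝ≥0} (hh : Measurable h) : Measurable (divOneAdd h) := by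
  have := (measurable_divOneAdd_prod (X := Unit) (h := fun p : Unit × E => h p.2)
    (hh.comp measurable_snd)).comp (measurable_prodMk_left (x := ()))
  simpa only [Function.comp_def] using this

lemma powKernel_divOneAdd {h : E → ℝ≥0} (hh : Measurable h) (n : ℕ) (m : Measure E) :
    powKernel E n (divOneAdd h m) =
      (powKernel E n m).withDensity fun z => ∏ i, (((1 + h (z i))⁻¹ : ℝ≥0) : ℝ≥0∞) := by
  have : IsFiniteMeasure ((finitePart m).withDensity fun y => ((1 + h y)⁻¹ : ℝ≥0)) :=
    inferInstanceAs (IsFiniteMeasure (divOneAdd h m))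
  rw [powKernel_apply, finitePart_eq, powKernel_apply, divOneAdd]
  exact pi_withDensity (fun _ => finitePart m) fun _ => by fun_prop

end FinitePart

lemma measurable_expNeg_lintegral {E : Type*} [MeasurableSpace E] {g : E → ℝ≥0}
    (hg : Measurable g) : Measurable fun m : Measure E => expNeg (∫⁻ y, g y ∂m) :=
  measurable_expNeg.comp (Measure.measurable_lintegral hg.coe_nnreal_ennreal)

lemma IsCRM.lintegral_expNeg {E : Type*} [MeasurableSpace E] {Q : Measure (Measure E)}
    {ν : Measure (ℝ × E)} (hQ : IsCRM Q ν) {h : E → ℝ≥0} (hh : Measurable h) :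
    ∫⁻ m, expNeg (∫⁻ y, h y ∂m) ∂Q = expNeg (levyExponent ν h) := hQ.laplace h hh

/-! ### Exponential tilting of the gamma process -/

section Tilting

variable {E : Type*} [MeasurableSpace E] {α : ℝ} {G₀ : Measure E} [IsProbabilityMeasure G₀]
  {Q : Measure (Measure E)}

lemma lintegral_expNeg_divOneAdd (hα : 0 < α) (hQ : IsCRM Q (gammaLevy α G₀)) {h g : E → ℝ≥0}
    (hh : Measurable h) (hg : Measurable g) :
    ∫⁻ m, expNeg (∫⁻ y, g y ∂(divOneAdd h m)) ∂Q =
      expNeg (levyExponent (gammaLevy α G₀) fun y => g y / (1 + h y)) := by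
  rw [← hQ.lintegral_expNeg (by fun_prop)]
  refine lintegral_congr_ae ?_
  filter_upwards [hQ.ae_isFiniteMeasure hα] with m hm
  rw [lintegral_divOneAdd hh m hg, finitePart_eq]

/-- The completely random measure with inhomogeneous intensity is the gamma process divided by
`1 + h`. -/
lemma isCRM_map_divOneAdd (hα : 0 < α) (hQ : IsCRM Q (gammaLevy α G₀)) {h : E → ℝ≥0}
    (hh : Measurable h) :
    IsCRM (Q.map (divOneAdd h)) (inhomLevy α G₀ fun y => h y) := by
  have := hQ.isProbabilityMeasure
  have := Measure.isProbabilityMeasure_map (μ := Q) (measurable_divOneAdd hh).aemeasurable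
  refine isCRM_of_laplace ?_ fun g hg => ?_
  · rw [ae_map_iff (measurable_divOneAdd hh).aemeasurable measurableSet_isFiniteMeasure]
    exact ae_of_all _ fun m => inferInstance
  · rw [lintegral_map (measurable_expNeg_lintegral hg)
      (measurable_divOneAdd hh), lintegral_expNeg_divOneAdd hα hQ hh hg,
      levyExponent_inhomLevy_eq_div hh hg]

/-- Quasi-invariance of the gamma process: tilting its law by `exp (-∫ h dm)` amounts, up to
normalization, to dividing the random measure by `1 + h`. -/
theorem withDensity_expNeg_eq (hα : 0 < α) (hQ : IsCRM Q (gammaLevy α G₀)) {h : E → ℝ≥0}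
    (hh : Measurable h) :
    Q.withDensity (fun m => expNeg (∫⁻ y, h y ∂m)) =
      expNeg (levyExponent (gammaLevy α G₀) h) • Q.map (divOneAdd h) := by
  have := hQ.isProbabilityMeasure
  have := Measure.isProbabilityMeasure_map (μ := Q) (measurable_divOneAdd hh).aemeasurable
  have hne : expNeg (levyExponent (gammaLevy α G₀) h) ≠ ∞ :=
    ne_top_of_le_ne_top ENNReal.one_ne_top (expNeg_le_one _)
  have : IsFiniteMeasure (expNeg (levyExponent (gammaLevy α G₀) h) • Q.map (divOneAdd h)) :=
    Measure.smul_finite _ hne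
  have : IsFiniteMeasure (Q.withDensity fun m => expNeg (∫⁻ y, h y ∂m)) :=
    isFiniteMeasure_withDensity (by rw [hQ.laplace h hh]; exact hne)
  refine Measure.ext_of_laplaceFunctional ?_ ?_ fun g hg => ?_
  · exact (withDensity_absolutelyContinuous _ _).ae_le (hQ.ae_isFiniteMeasure hα)
  · refine Measure.ae_smul_measure ?_ _
    rw [ae_map_iff (measurable_divOneAdd hh).aemeasurable measurableSet_isFiniteMeasure]
    exact ae_of_all _ fun m => inferInstance
  · rw [lintegral_withDensity_eq_lintegral_mul _ (measurable_expNeg_lintegral hh)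
      (measurable_expNeg_lintegral hg), lintegral_smul_measure,
      lintegral_map (measurable_expNeg_lintegral hg) (measurable_divOneAdd hh),
      lintegral_expNeg_divOneAdd hα hQ hh hg, smul_eq_mul, ← expNeg_add,
      ← levyExponent_gammaLevy_add hh hg, ← hQ.lintegral_expNeg (by fun_prop)]
    refine lintegral_congr fun m => ?_
    rw [Pi.mul_apply, ← expNeg_add, ← lintegral_add_left (by fun_prop)]
    simp

/-- Tilting the gamma process by `exp (-∫ h dm)` changes its `n`-th moment measure by the product
density `∏ᵢ (1 + h(zᵢ))⁻¹`. -/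
theorem lintegral_expNeg_mul_powKernel (hα : 0 < α) (hQ : IsCRM Q (gammaLevy α G₀)) {h : E → ℝ≥0}
    (hh : Measurable h) {n : ℕ} {G : (Fin n → E) → ℝ≥0∞} (hG : Measurable G) :
    ∫⁻ m, expNeg (∫⁻ y, h y ∂m) * ∫⁻ z, G z ∂(powKernel E n m) ∂Q =
      expNeg (levyExponent (gammaLevy α G₀) h) *
        ∫⁻ m, ∫⁻ z, (∏ i, (((1 + h (z i))⁻¹ : ℝ≥0) : ℝ≥0∞)) * G z ∂(powKernel E n m) ∂Q := by
  have hGm : Measurable fun m => ∫⁻ z, G z ∂(powKernel E n m) :=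
    (Measure.measurable_lintegral hG).comp (powKernel E n).measurable
  have := lintegral_withDensity_eq_lintegral_mul Q (measurable_expNeg_lintegral hh) hGm
  simp only [Pi.mul_apply] at this
  rw [← this, withDensity_expNeg_eq hα hQ hh, lintegral_smul_measure,
    lintegral_map hGm (measurable_divOneAdd hh), smul_eq_mul]
  congr 1
  refine lintegral_congr fun m => ?_
  rw [powKernel_divOneAdd hh, lintegral_withDensity_eq_lintegral_mul _ (by fun_prop) hG]
  rfl

end Tilting

/-! ### Adding fixed atoms to a random measure -/

section Atoms

variable {E : Type*} [MeasurableSpace E]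

/-- The measure `m + ∑ᵢ wᵢ δ_{vᵢ}`. -/
noncomputable def addAtoms {n : ℕ} (v : Fin n → E) (p : Measure E × (Fin n → ℝ)) : Measure E :=
  p.1 + ∑ i, ENNReal.ofReal (p.2 i) • Measure.dirac (v i)

lemma isFiniteMeasure_addAtoms {n : ℕ} (v : Fin n → E) (p : Measure E × (Fin n → ℝ))
    [IsFiniteMeasure p.1] : IsFiniteMeasure (addAtoms v p) := by
  refine ⟨?_⟩
  simp only [addAtoms, Measure.add_apply, Measure.finsetSum_apply, Measure.smul_apply,
    smul_eq_mul, measure_univ, mul_one]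
  exact ENNReal.add_lt_top.2 ⟨measure_lt_top _ _, ENNReal.sum_lt_top.2 fun i _ => by finiteness⟩

lemma addAtoms_apply {n : ℕ} (v : Fin n → E) (p : Measure E × (Fin n → ℝ)) {s : Set E}
    (hs : MeasurableSet s) :
    addAtoms v p s = p.1 s + ∑ i, ENNReal.ofReal (p.2 i) * s.indicator 1 (v i) := by
  simp [addAtoms, hs]

lemma Measurable.addAtoms {X : Type*} [MeasurableSpace X] {n : ℕ} {v : X → Fin n → E}
    {p : X → Measure E × (Fin n → ℝ)} (hv : Measurable v) (hp : Measurable p) :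
    Measurable fun x => addAtoms (v x) (p x) := by
  refine Measure.measurable_of_measurable_coe _ fun s hs => ?_
  simp_rw [addAtoms_apply _ _ hs]
  refine ((Measure.measurable_coe hs).comp hp.fst).add (Finset.measurable_fun_sum _ fun i _ => ?_)
  exact (by fun_prop : Measurable fun x => ENNReal.ofReal ((p x).2 i)).mul
    ((measurable_one.indicator hs).comp (by fun_prop : Measurable fun x => v x i))

lemma measurable_addAtoms {n : ℕ} (v : Fin n → E) : Measurable (addAtoms v) :=
  Measurable.addAtoms (v := fun _ => v) measurable_const measurable_id

lemma lintegral_addAtoms {n : ℕ} (v : Fin n → E) (p : Measure E × (Fin n → ℝ)) {g : E → ℝ≥0∞}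
    (hg : Measurable g) :
    ∫⁻ y, g y ∂(addAtoms v p) = ∫⁻ y, g y ∂p.1 + ∑ i, ENNReal.ofReal (p.2 i) * g (v i) := by
  simp [addAtoms, lintegral_add_measure, lintegral_finsetSum_measure, lintegral_smul_measure,
    lintegral_dirac' _ hg]

/-- The Laplace functional of a random measure with additional independent fixed atoms. -/
lemma lintegral_expNeg_map_addAtoms {n : ℕ} (v : Fin n → E) (Q : Measure (Measure E)) [SFinite Q]
    (ρ : Fin n → Measure ℝ) [∀ i, IsProbabilityMeasure (ρ i)] {g : E → ℝ≥0} (hg : Measurable g) :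
    ∫⁻ m, expNeg (∫⁻ y, g y ∂m) ∂((Q.prod (Measure.pi ρ)).map (addAtoms v)) =
      (∫⁻ m, expNeg (∫⁻ y, g y ∂m) ∂Q) *
        ∏ i, ∫⁻ x, expNeg (ENNReal.ofReal x * g (v i)) ∂(ρ i) := by
  rw [lintegral_map (measurable_expNeg_lintegral hg) (measurable_addAtoms v)]
  simp_rw [lintegral_addAtoms v _ hg.coe_nnreal_ennreal, expNeg_add, expNeg_sum]
  rw [lintegral_prod_mul (f := fun m => expNeg (∫⁻ y, g y ∂m))
    (g := fun w : Fin n → ℝ => ∏ i, expNeg (ENNReal.ofReal (w i) * g (v i)))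
    (measurable_expNeg_lintegral hg).aemeasurable
    (Finset.measurable_fun_prod _ fun i _ => by fun_prop).aemeasurable,
    lintegral_pi_prod ρ (f := fun i x => expNeg (ENNReal.ofReal x * g (v i)))
      fun i => by fun_prop]

end Atoms

/-- The Laplace transform of the gamma distribution. -/
lemma lintegral_expNeg_gammaMeasure {a r : ℝ} (ha : 0 < a) (hr : 0 < r) (t : ℝ≥0) :
    ∫⁻ x, expNeg (ENNReal.ofReal x * t) ∂(gammaMeasure a r) =
      ENNReal.ofReal ((r / (r + t)) ^ a) := by
  have hrt : 0 < r + t := by positivity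
  rw [gammaMeasure, lintegral_withDensity_eq_lintegral_mul _
    (by unfold gammaPDF; fun_prop) (by fun_prop)]
  calc _ = ∫⁻ x, ENNReal.ofReal ((r / (r + t)) ^ a) * gammaPDF a (r + t) x := by
        refine lintegral_congr fun x => ?_
        rw [Pi.mul_apply]
        rcases lt_or_ge x 0 with hx | hx
        · rw [gammaPDF_of_neg hx, gammaPDF_of_neg hx, zero_mul, mul_zero]
        rw [gammaPDF_of_nonneg hx, gammaPDF_of_nonneg hx, expNeg_of_ne_top (by finiteness),
          ENNReal.toReal_mul, ENNReal.toReal_ofReal hx, ENNReal.coe_toReal,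
          ← ENNReal.ofReal_mul' (Real.exp_pos _).le, ← ENNReal.ofReal_mul (by positivity)]
        congr 1
        rw [Real.div_rpow hr.le hrt.le, show -((r + t) * x) = -(r * x) + -(x * t) by ring,
          Real.exp_add]
        have := (Real.rpow_pos_of_pos hrt a).ne'
        field_simp
    _ = _ := by
        rw [lintegral_const_mul _ (by unfold gammaPDF; fun_prop), lintegral_gammaPDF_eq_one ha hrt,
          mul_one]

lemma ae_pos_gammaMeasure (a r : ℝ) : ∀ᵐ x ∂(gammaMeasure a r), 0 < x := by
  rw [gammaMeasure, ae_withDensity_iff (by unfold gammaPDF; fun_prop)]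
  filter_upwards [Measure.ae_ne volume (0 : ℝ)] with x hx0 hx
  refine lt_of_le_of_ne (not_lt.1 fun h => hx (gammaPDF_of_neg h)) (Ne.symm hx0)

/-! ### The posterior kernel -/

lemma numTies_pos {E : Type*} {n k : ℕ} {v : Fin n → E} {zs : Fin k → E}
    (hrange : Set.range zs = Set.range v) (l : Fin k) : 0 < numTies v (zs l) := by
  obtain ⟨i, hi⟩ : zs l ∈ Set.range v := hrange ▸ ⟨l, rfl⟩
  exact (Set.ncard_pos).2 ⟨i, hi⟩

section Posterior

variable {E : Type*} [MeasurableSpace E] {U : Type*} [MeasurableSpace U]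

/-- The posterior law of the random measure, as a kernel: to `(u, v)` is attached the law of
`m / (1 + ψ_u) + ∑ᵢ eᵢ / (1 + ψ_u(vᵢ)) δ_{vᵢ}`, where `m` has law `Q` and the `eᵢ` are independent
standard exponential variables. There is one exponential atom per observation rather than one gamma
atom per distinct value, so that the definition is measurable in `v` across ties. -/
noncomputable def posteriorKernel (Q : Measure (Measure E)) (ψ : U × E → ℝ≥0) (n : ℕ) :
    Kernel (U × (Fin n → E)) (Measure E) :=
  (Kernel.id ×ₖ Kernel.const _ (Q.prod (Measure.pi fun _ : Fin n => expMeasure 1))).map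
    fun p => addAtoms p.1.2 (divOneAdd (fun y => ψ (p.1.1, y)) p.2.1,
      fun i => p.2.2 i / (1 + ψ (p.1.1, p.1.2 i)))

variable {Q : Measure (Measure E)} {ψ : U × E → ℝ≥0} {n : ℕ}

instance : IsProbabilityMeasure (expMeasure 1) := isProbabilityMeasure_expMeasure one_pos

lemma measurable_posterior (hψ : Measurable ψ) :
    Measurable fun p : (U × (Fin n → E)) × (Measure E × (Fin n → ℝ)) =>
      addAtoms p.1.2 (divOneAdd (fun y => ψ (p.1.1, y)) p.2.1,
        fun i => p.2.2 i / (1 + ψ (p.1.1, p.1.2 i))) := by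
  have := (measurable_divOneAdd_prod hψ).comp
    (by fun_prop : Measurable fun p : (U × (Fin n → E)) × (Measure E × (Fin n → ℝ)) =>
      (p.1.1, p.2.1))
  simp only [Function.comp_def] at this
  exact Measurable.addAtoms (by fun_prop) (this.prodMk (by fun_prop))

lemma ae_isFiniteMeasure_posteriorKernel (hψ : Measurable ψ) (p : U × (Fin n → E)) :
    ∀ᵐ m ∂(posteriorKernel Q ψ n p), IsFiniteMeasure m := by
  rw [posteriorKernel, Kernel.map_apply _ (measurable_posterior hψ),
    ae_map_iff (measurable_posterior hψ).aemeasurable measurableSet_isFiniteMeasure]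
  exact ae_of_all _ fun q => isFiniteMeasure_addAtoms _ _

variable [IsProbabilityMeasure Q]

lemma isMarkovKernel_posteriorKernel (hψ : Measurable ψ) :
    IsMarkovKernel (posteriorKernel Q ψ n) :=
  Kernel.IsMarkovKernel.map _ (measurable_posterior hψ)

lemma posteriorKernel_apply (hψ : Measurable ψ) (u : U) (v : Fin n → E) :
    posteriorKernel Q ψ n (u, v) =
      ((Q.map (divOneAdd fun y => ψ (u, y))).prod
        (Measure.pi fun i => (expMeasure 1).map fun x : ℝ => x / (1 + ψ (u, v i)))).map
          (addAtoms v) := by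
  have : ∀ i, IsProbabilityMeasure ((expMeasure 1).map fun x : ℝ => x / (1 + (ψ (u, v i) : ℝ))) :=
    fun i => Measure.isProbabilityMeasure_map (by fun_prop)
  have hd : Measurable (divOneAdd fun y => ψ (u, y)) := measurable_divOneAdd (by fun_prop)
  have := Measure.isProbabilityMeasure_map (μ := Q) hd.aemeasurable
  rw [posteriorKernel, Kernel.map_apply _ (measurable_posterior hψ), Kernel.prod_apply,
    Kernel.id_apply, Kernel.const_apply, Measure.dirac_prod,
    Measure.map_map (measurable_posterior hψ) (by fun_prop),
    ← Measure.pi_map_pi fun i => by fun_prop, Measure.map_prod_map _ _ hd (by fun_prop),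
    Measure.map_map (measurable_addAtoms v) (by fun_prop)]
  rfl

lemma lintegral_expNeg_posteriorKernel {α : ℝ} (hα : 0 < α) {G₀ : Measure E}
    [IsProbabilityMeasure G₀] (hQ : IsCRM Q (gammaLevy α G₀)) (hψ : Measurable ψ) (u : U)
    (v : Fin n → E) {g : E → ℝ≥0} (hg : Measurable g) :
    ∫⁻ m, expNeg (∫⁻ y, g y ∂m) ∂(posteriorKernel Q ψ n (u, v)) =
      expNeg (levyExponent (gammaLevy α G₀) fun y => g y / (1 + ψ (u, y))) *
        ∏ i, (((1 + ψ (u, v i)) / (1 + ψ (u, v i) + g (v i)) : ℝ≥0) : ℝ≥0∞) := by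
  have : ∀ i, IsProbabilityMeasure ((expMeasure 1).map fun x : ℝ => x / (1 + (ψ (u, v i) : ℝ))) :=
    fun i => Measure.isProbabilityMeasure_map (by fun_prop)
  have hd : Measurable (divOneAdd fun y => ψ (u, y)) := measurable_divOneAdd (by fun_prop)
  have := Measure.isProbabilityMeasure_map (μ := Q) hd.aemeasurable
  rw [posteriorKernel_apply hψ, lintegral_expNeg_map_addAtoms v _ _ hg,
    lintegral_map (measurable_expNeg_lintegral hg) hd,
    lintegral_expNeg_divOneAdd hα hQ (by fun_prop) hg]
  congr 1
  refine Finset.prod_congr rfl fun i _ => ?_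
  rw [lintegral_map (by fun_prop) (by fun_prop)]
  calc _ = ∫⁻ x, expNeg (ENNReal.ofReal x * (g (v i) / (1 + ψ (u, v i)) : ℝ≥0))
          ∂(gammaMeasure 1 1) := by
        refine lintegral_congr fun x => ?_
        rw [ENNReal.ofReal_div_of_pos (by positivity), ENNReal.coe_div (by positivity),
          show (1 + (ψ (u, v i) : ℝ)) = ((1 + ψ (u, v i) : ℝ≥0) : ℝ) by push_cast; rfl,
          ENNReal.ofReal_coe_nnreal, div_eq_mul_inv, div_eq_mul_inv, mul_right_comm, mul_assoc]
    _ = _ := by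
        rw [lintegral_expNeg_gammaMeasure one_pos one_pos, Real.rpow_one,
          ← ENNReal.ofReal_coe_nnreal]
        congr 1
        push_cast
        have : (0 : ℝ) < 1 + ψ (u, v i) := by positivity
        field_simp

/-- The exponential atoms at tied observations add up to gamma atoms. -/
theorem posteriorKernel_eq_map_addAtoms {α : ℝ} (hα : 0 < α) {G₀ : Measure E}
    [IsProbabilityMeasure G₀] (hQ : IsCRM Q (gammaLevy α G₀)) (hψ : Measurable ψ) (u : U)
    (v : Fin n → E) {k : ℕ} {zs : Fin k → E} (hinj : Function.Injective zs)
    (hrange : Set.range zs = Set.range v) :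
    posteriorKernel Q ψ n (u, v) =
      ((Q.map (divOneAdd fun y => ψ (u, y))).prod
        (Measure.pi fun l => gammaMeasure (numTies v (zs l)) (ψ (u, zs l) + 1))).map
          (addAtoms zs) := by
  have hpos := numTies_pos hrange
  have hprob : ∀ l, IsProbabilityMeasure
      (gammaMeasure (numTies v (zs l)) (ψ (u, zs l) + 1)) := fun l =>
    isProbabilityMeasure_gammaMeasure (by exact_mod_cast hpos l) (by positivity)
  have hd : Measurable (divOneAdd fun y => ψ (u, y)) := measurable_divOneAdd (by fun_prop)
  have := Measure.isProbabilityMeasure_map (μ := Q) hd.aemeasurable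
  have hadd : Measurable (addAtoms zs) := measurable_addAtoms zs
  have := isMarkovKernel_posteriorKernel (Q := Q) (n := n) hψ
  refine Measure.ext_of_laplaceFunctional (ae_isFiniteMeasure_posteriorKernel hψ _) ?_
    fun g hg => ?_
  · rw [ae_map_iff hadd.aemeasurable measurableSet_isFiniteMeasure]
    have : ∀ᵐ m ∂(Q.map (divOneAdd fun y => ψ (u, y))), IsFiniteMeasure m := by
      rw [ae_map_iff hd.aemeasurable measurableSet_isFiniteMeasure]
      exact ae_of_all _ fun m => inferInstance
    filter_upwards [Measure.quasiMeasurePreserving_fst.ae this] with p hp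
    exact isFiniteMeasure_addAtoms _ _
  · rw [lintegral_expNeg_posteriorKernel hα hQ hψ u v hg, lintegral_expNeg_map_addAtoms zs _ _ hg,
      lintegral_map (measurable_expNeg_lintegral hg) hd,
      lintegral_expNeg_divOneAdd hα hQ (by fun_prop) hg]
    congr 1
    have he : ∀ i, ∃ l, zs l = v i := fun i => by
      have : v i ∈ Set.range zs := hrange ▸ ⟨i, rfl⟩
      exact this
    choose e he using he
    classical
    rw [← Finset.prod_fiberwise (s := Finset.univ) (g := e)]
    refine Finset.prod_congr rfl fun l _ => ?_
    have hfib : ∀ i, e i = l ↔ v i = zs l := fun i => by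
      rw [← he i, hinj.eq_iff]
    rw [lintegral_expNeg_gammaMeasure (by exact_mod_cast hpos l) (by positivity),
      Real.rpow_natCast, Finset.prod_congr rfl fun i hi => by
        rw [(hfib i).1 (Finset.mem_filter.1 hi).2], Finset.prod_const,
      ENNReal.ofReal_pow (by positivity)]
    congr 1
    · rw [← ENNReal.ofReal_coe_nnreal]
      congr 1
      push_cast
      ring
    · rw [numTies, ← Set.ncard_coe_finset]
      congr 1
      ext i
      simp [hfib]

end Posterior

/-! ### Recovering the atoms -/

section Recover

variable {E : Type*} [MeasurableSpace E] [MeasurableSingletonClass E]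

/-- A completely random measure with inhomogeneous intensity has no atom where the base measure
has none. -/
lemma ae_measure_singleton_eq_zero {Q : Measure (Measure E)} {α : ℝ} {G₀ : Measure E} [SFinite G₀]
    {ψ : E → ℝ} (hψ : Measurable ψ) (hQ : IsCRM Q (inhomLevy α G₀ ψ)) {a : E} (ha : G₀ {a} = 0) :
    ∀ᵐ m ∂Q, m {a} = 0 := by
  have := hQ.isProbabilityMeasure
  have hm : Measurable (({a} : Set E).indicator fun _ => (1 : ℝ≥0)) :=
    measurable_const.indicator (measurableSet_singleton a)
  have hexp : levyExponent (inhomLevy α G₀ ψ) (({a} : Set E).indicator fun _ => 1) = 0 := by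
    rw [levyExponent_inhomLevy hψ hm, lintegral_smul_measure]
    have : ∫⁻ y, frullani (1 + ψ y) (({a} : Set E).indicator (fun _ => (1 : ℝ≥0)) y : ℝ≥0) ∂G₀ =
        0 := by
      have hae : ∀ᵐ y ∂G₀, y ∉ ({a} : Set E) := measure_eq_zero_iff_ae_notMem.1 ha
      rw [← lintegral_zero (μ := G₀)]
      refine lintegral_congr_ae ?_
      filter_upwards [hae] with y hy
      simp [Set.indicator_of_notMem hy, frullani]
    rw [this, smul_zero]
  have h1 := hQ.lintegral_expNeg hm
  simp only [ENNReal.coe_indicator, lintegral_indicator_const (measurableSet_singleton a),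
    ENNReal.coe_one, one_mul] at h1
  rw [hexp, expNeg_zero] at h1
  have hmeas : Measurable fun m : Measure E => expNeg (m {a}) :=
    measurable_expNeg.comp (Measure.measurable_coe (measurableSet_singleton a))
  have h2 : (fun m : Measure E => expNeg (m {a})) =ᵐ[Q] fun _ => 1 :=
    ae_eq_of_ae_le_of_lintegral_le (ae_of_all _ fun m => expNeg_le_one _)
      (by rw [h1]; exact ENNReal.one_ne_top) aemeasurable_const (by rw [h1]; simp)
  filter_upwards [h2] with m hm
  exact eq_zero_of_expNeg_eq_one hm

lemma addAtoms_singleton {k : ℕ} {zs : Fin k → E} (hinj : Function.Injective zs)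
    (p : Measure E × (Fin k → ℝ)) (l : Fin k) :
    addAtoms zs p {zs l} = p.1 {zs l} + ENNReal.ofReal (p.2 l) := by
  classical
  rw [addAtoms_apply _ _ (measurableSet_singleton _), Finset.sum_eq_single l]
  · simp
  · intro j _ hj
    simp [hinj.ne hj]
  · simp

lemma ae_pos_map_addAtoms {k : ℕ} {zs : Fin k → E} (hinj : Function.Injective zs)
    {Q : Measure (Measure E)} [IsProbabilityMeasure Q] {ρ : Fin k → Measure ℝ}
    [∀ l, IsProbabilityMeasure (ρ l)] (hρ : ∀ l, ∀ᵐ x ∂(ρ l), 0 < x) :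
    ∀ᵐ m ∂((Q.prod (Measure.pi ρ)).map (addAtoms zs)), ∀ l, 0 < m {zs l} := by
  have hadd : Measurable (addAtoms zs) := measurable_addAtoms zs
  have hm : ∀ l, Measurable fun m : Measure E => m {zs l} :=
    fun l => Measure.measurable_coe (measurableSet_singleton _)
  have hset : MeasurableSet {m : Measure E | ∀ l, 0 < m {zs l}} := by
    rw [Set.ofPred_forall]
    exact MeasurableSet.iInter fun l => hm l measurableSet_Ioi
  rw [ae_map_iff hadd.aemeasurable hset]
  have hpos : ∀ᵐ w ∂(Measure.pi ρ), ∀ l, 0 < w l :=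
    ae_all_iff.2 fun l => Measure.quasiMeasurePreserving_eval ρ l |>.ae (hρ l)
  filter_upwards [Measure.quasiMeasurePreserving_snd.ae hpos] with p hp l
  rw [addAtoms_singleton hinj]
  exact lt_of_lt_of_le (ENNReal.ofReal_pos.2 (hp l)) le_add_self

/-- If the random measure does not charge the points `zs l`, then restricting to their complement
and reading off the atoms inverts `addAtoms`. -/
lemma map_restrict_map_addAtoms {k : ℕ} {zs : Fin k → E} (hinj : Function.Injective zs)
    {Q : Measure (Measure E)} [IsProbabilityMeasure Q] {ρ : Fin k → Measure ℝ}
    [∀ l, IsProbabilityMeasure (ρ l)] (hρ : ∀ l, ∀ᵐ x ∂(ρ l), 0 < x)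
    (hQ : ∀ l, ∀ᵐ m ∂Q, m {zs l} = 0) :
    ((Q.prod (Measure.pi ρ)).map (addAtoms zs)).map
      (fun m => (m.restrict (Set.range zs)ᶜ, fun l => (m {zs l}).toReal)) =
        Q.prod (Measure.pi ρ) := by
  have hadd : Measurable (addAtoms zs) := measurable_addAtoms zs
  have hrange : MeasurableSet (Set.range zs)ᶜ := (Set.finite_range zs).measurableSet.compl
  have hrest : Measurable fun m : Measure E => m.restrict (Set.range zs)ᶜ :=
    Measure.measurable_of_measurable_coe _ fun s hs => by
      simp_rw [Measure.restrict_apply hs]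
      exact Measure.measurable_coe (hs.inter hrange)
  have hmass : Measurable fun (m : Measure E) l => (m {zs l}).toReal :=
    measurable_pi_lambda _ fun l =>
      (Measure.measurable_coe (measurableSet_singleton _)).ennreal_toReal
  rw [Measure.map_map (hrest.prodMk hmass) hadd]
  refine (Measure.map_congr ?_).trans Measure.map_id
  have hpos : ∀ᵐ w ∂(Measure.pi ρ), ∀ l, 0 < w l :=
    ae_all_iff.2 fun l => Measure.quasiMeasurePreserving_eval ρ l |>.ae (hρ l)
  filter_upwards [Measure.quasiMeasurePreserving_snd.ae hpos,
    Measure.quasiMeasurePreserving_fst.ae (ae_all_iff.2 hQ)] with p hp h0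
  refine Prod.ext ?_ (funext fun l => ?_)
  · ext s hs
    simp only [Function.comp_apply, id]
    rw [Measure.restrict_apply hs, addAtoms_apply _ _ (hs.inter hrange),
      Finset.sum_eq_zero fun l _ => by simp, add_zero]
    have : p.1 (Set.range zs) = 0 := by
      rw [← Set.iUnion_singleton_eq_range]
      exact measure_iUnion_null h0
    exact measure_inter_conull (by rwa [compl_compl])
  · simp only [Function.comp_apply, id]
    rw [addAtoms_singleton hinj, h0, zero_add, ENNReal.toReal_ofReal (hp l).le]

end Recover

/-! ### Scaled exponential variables -/

lemma expMeasure_one_eq :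
    expMeasure 1 = (volume.restrict (Set.Ioi (0 : ℝ))).withDensity
      fun x => ENNReal.ofReal (Real.exp (-x)) := by
  rw [expMeasure, gammaMeasure, ← withDensity_indicator measurableSet_Ioi]
  refine withDensity_congr_ae ?_
  filter_upwards [Measure.ae_ne volume (0 : ℝ)] with x hx0
  rcases lt_or_gt_of_ne hx0 with hx | hx
  · rw [gammaPDF_of_neg hx, Set.indicator_of_notMem (by simpa using hx.le)]
  · rw [gammaPDF_of_nonneg hx.le, Set.indicator_of_mem (by simpa using hx)]
    simp

lemma expMeasure_one_map_div {T : ℝ} (hT : 0 < T) :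
    (expMeasure 1).map (fun x => x / T) = (volume.restrict (Set.Ioi (0 : ℝ))).withDensity
      fun u => ENNReal.ofReal (T * Real.exp (-(u * T))) := by
  have himg : (fun u : ℝ => T * u) '' Set.Ioi 0 = Set.Ioi 0 := by
    rw [Set.image_mul_left_Ioi hT, mul_zero]
  ext s hs
  have hs' : MeasurableSet ((fun x => x / T) ⁻¹' s) := measurable_id.div_const T hs
  rw [Measure.map_apply (by fun_prop) hs, expMeasure_one_eq, withDensity_apply _ hs',
    withDensity_apply _ hs, ← lintegral_indicator hs', ← lintegral_indicator hs]
  conv_lhs => rw [← himg]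
  rw [lintegral_image_eq_lintegral_abs_deriv_mul measurableSet_Ioi
    (f' := fun _ => T) (fun x _ => by simpa using ((hasDerivAt_id x).const_mul T).hasDerivWithinAt)
    (mul_right_injective₀ hT.ne').injOn]
  refine lintegral_congr fun u => ?_
  have hdiv : T * u / T = u := by field_simp
  by_cases hu : u ∈ s
  · rw [Set.indicator_of_mem hu, Set.indicator_of_mem (by simpa [hdiv] using hu), abs_of_pos hT,
      ← ENNReal.ofReal_mul hT.le, mul_comm u T]
  · rw [Set.indicator_of_notMem hu, Set.indicator_of_notMem (by simpa [hdiv] using hu), mul_zero]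

/-! ### The joint law of the sample -/

section Sample

variable {Y : Set ℝ} {n : ℕ}

lemma tiltMass_nonneg (θ : ℝ) (m : Measure Y) : 0 ≤ tiltMass θ m :=
  integral_nonneg fun _ => (Real.exp_pos _).le

@[fun_prop] lemma measurable_tiltMass (θ : ℝ) :
    Measurable fun m : Measure Y => tiltMass θ m := by
  have : ∀ m : Measure Y, tiltMass θ m =
      (∫⁻ y : Y, ENNReal.ofReal (Real.exp (θ * (y : ℝ))) ∂m).toReal := fun m =>
    integral_eq_lintegral_of_nonneg_ae (ae_of_all _ fun _ => (Real.exp_pos _).le)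
      (by fun_prop : Measurable fun y : Y => Real.exp (θ * (y : ℝ))).aestronglyMeasurable
  simp_rw [this]
  exact (Measure.measurable_lintegral (by fun_prop)).ennreal_toReal

lemma ofReal_tiltMass {θ : ℝ} {m : Measure Y} (h : 0 < tiltMass θ m) :
    ENNReal.ofReal (tiltMass θ m) = ∫⁻ y : Y, ENNReal.ofReal (Real.exp (θ * (y : ℝ))) ∂m :=
  ofReal_integral_eq_lintegral_ofReal
    (by_contra fun hi => h.ne' (integral_undef hi)) (ae_of_all _ fun _ => (Real.exp_pos _).le)

/-- `ψ(y; u, θ)` with values in `[0, ∞)`, the negative parts of the `uᵢ` being discarded. -/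
noncomputable def psiNN (θ : Fin n → ℝ) (p : (Fin n → ℝ) × Y) : ℝ≥0 :=
  ∑ i, (p.1 i).toNNReal * (Real.exp (θ i * (p.2 : ℝ))).toNNReal

@[fun_prop] lemma measurable_psiNN (θ : Fin n → ℝ) : Measurable (psiNN (Y := Y) θ) := by
  unfold psiNN
  fun_prop

lemma coe_psiNN (θ : Fin n → ℝ) {u : Fin n → ℝ} (hu : ∀ i, 0 ≤ u i) (y : Y) :
    (psiNN θ (u, y) : ℝ) = psi u θ y := by
  simp only [psiNN, psi, NNReal.coe_sum, NNReal.coe_mul]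
  exact Finset.sum_congr rfl fun i _ => by
    rw [Real.coe_toNNReal _ (hu i), Real.coe_toNNReal _ (Real.exp_pos _).le]

/-- `∏ᵢ exp (-uᵢ Tᵢ(m)) = exp (-∫ ψ_u dm)`. -/
lemma expNeg_lintegral_psiNN (θ : Fin n → ℝ) {u : Fin n → ℝ} (hu : ∀ i, 0 ≤ u i) {m : Measure Y}
    (hm : ∀ i, 0 < tiltMass (θ i) m) :
    expNeg (∫⁻ y, psiNN θ (u, y) ∂m) =
      ∏ i, ENNReal.ofReal (Real.exp (-(u i * tiltMass (θ i) m))) := by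
  simp only [psiNN, ENNReal.ofNNReal_finsetSum, ENNReal.coe_mul]
  rw [lintegral_finsetSum _ fun i _ => by fun_prop, expNeg_sum]
  refine Finset.prod_congr rfl fun i _ => ?_
  rw [lintegral_const_mul _ (by fun_prop)]
  change expNeg (ENNReal.ofReal (u i) * ∫⁻ y : Y, ENNReal.ofReal (Real.exp (θ i * (y : ℝ))) ∂m) = _
  rw [← ofReal_tiltMass (hm i), ← ENNReal.ofReal_mul (hu i),
    expNeg_of_ne_top ENNReal.ofReal_ne_top,
    ENNReal.toReal_ofReal (mul_nonneg (hu i) (tiltMass_nonneg _ _))]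

variable {Ω : Type*} [MeasurableSpace Ω] {P : Measure Ω} [IsProbabilityMeasure P]
  {θ : Fin n → ℝ} {μ : Ω → Measure Y} {z : Ω → Fin n → Y}

/-- The tilted masses of the random measure are almost surely positive (and finite, as otherwise
the Bochner integral would vanish). -/
lemma IsTiltedSample.ae_tiltMass_pos (hz : IsTiltedSample P θ μ z) (hμ : Measurable μ) :
    ∀ᵐ m ∂(P.map μ), ∀ i, 0 < tiltMass (θ i) m := by
  have hset : MeasurableSet {m : Measure Y | ∀ i, 0 < tiltMass (θ i) m} := by
    rw [Set.ofPred_forall]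
    exact MeasurableSet.iInter fun i => measurable_tiltMass (θ i) measurableSet_Ioi
  rw [ae_map_iff hμ.aemeasurable hset]
  have h1 := hz.joint Set.univ (fun _ => Set.univ) MeasurableSet.univ fun _ => MeasurableSet.univ
  simp only [Set.mem_univ, true_and, implies_true, Set.ofPred_true, measure_univ,
    Measure.restrict_univ] at h1
  have h2 : (fun ω => ∏ i, (μ ω).tilted (fun y => θ i * (y : ℝ)) Set.univ) =ᵐ[P] fun _ => 1 :=
    ae_eq_of_ae_le_of_lintegral_le
      (ae_of_all _ fun ω => Finset.prod_le_one' fun i _ => prob_le_one)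
      (by rw [← h1]; exact ENNReal.one_ne_top) aemeasurable_const (by rw [← h1]; simp)
  filter_upwards [h2] with ω hω i
  refine lt_of_le_of_ne (tiltMass_nonneg _ _) fun h0 => ?_
  have hne : (μ ω).tilted (fun y => θ i * (y : ℝ)) Set.univ ≠ 0 := fun h => by
    rw [Finset.prod_eq_zero (f := fun i => (μ ω).tilted (fun y => θ i * (y : ℝ)) Set.univ)
      (Finset.mem_univ i) h] at hω
    exact zero_ne_one hω
  refine hne ?_
  have h0' : ∫ y : Y, Real.exp (θ i * (y : ℝ)) ∂(μ ω) = 0 := h0.symm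
  simp [Measure.tilted, h0']

/-- The joint law of `(μ, z)` has the normalized tilted weights as a density with respect to the
measure `law(μ)(dm) m(dz₁) ⋯ m(dzₙ)`. -/
lemma IsTiltedSample.map_eq (hz : IsTiltedSample P θ μ z) (hμ : Measurable μ)
    (hfin : ∀ᵐ m ∂(P.map μ), IsFiniteMeasure m) :
    P.map (fun ω => (μ ω, z ω)) = (P.map μ ⊗ₘ powKernel Y n).withDensity
      fun p => ∏ i, ENNReal.ofReal (Real.exp (θ i * (p.2 i : ℝ)) / tiltMass (θ i) p.1) := by
  have := Measure.isProbabilityMeasure_map (μ := P) hμ.aemeasurable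
  have hpair : Measurable fun ω => (μ ω, z ω) := hμ.prodMk hz.measurable
  have := Measure.isProbabilityMeasure_map (μ := P) hpair.aemeasurable
  have hdens : Measurable fun p : Measure Y × (Fin n → Y) =>
      ∏ i, ENNReal.ofReal (Real.exp (θ i * (p.2 i : ℝ)) / tiltMass (θ i) p.1) := by fun_prop
  -- Agreement on the boxes `A × B₁ × ⋯ × Bₙ`; the general case follows by a π-system argument.
  have key : ∀ (A : Set (Measure Y)) (B : Fin n → Set Y), MeasurableSet A →
      (∀ i, MeasurableSet (B i)) → P.map (fun ω => (μ ω, z ω)) (A ×ˢ Set.univ.pi B) =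
      (P.map μ ⊗ₘ powKernel Y n).withDensity (fun p => ∏ i,
        ENNReal.ofReal (Real.exp (θ i * (p.2 i : ℝ)) / tiltMass (θ i) p.1))
          (A ×ˢ Set.univ.pi B) := by
    intro A B hA hB
    have hpi := MeasurableSet.univ_pi hB
    rw [Measure.map_apply hpair (hA.prod hpi), withDensity_apply _ (hA.prod hpi),
      Measure.setLIntegral_compProd hdens hA hpi]
    have h1 : (fun ω => (μ ω, z ω)) ⁻¹' (A ×ˢ Set.univ.pi B) =
        {ω | μ ω ∈ A ∧ ∀ i, z ω i ∈ B i} := by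
      ext ω
      simp
    have h2 : ∀ᵐ m ∂((P.map μ).restrict A),
        ∫⁻ v in Set.univ.pi B, ∏ i, ENNReal.ofReal
          (Real.exp (θ i * (v i : ℝ)) / tiltMass (θ i) m) ∂(powKernel Y n m) =
        ∏ i, m.tilted (fun y => θ i * (y : ℝ)) (B i) := by
      filter_upwards [ae_restrict_of_ae hfin] with m hm
      rw [← withDensity_apply _ hpi, powKernel_apply, finitePart_eq]
      have : ∀ i, IsFiniteMeasure (m.withDensity fun y : Y =>
          ENNReal.ofReal (Real.exp (θ i * (y : ℝ)) / tiltMass (θ i) m)) := fun i =>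
        inferInstanceAs (IsFiniteMeasure (m.tilted fun y : Y => θ i * (y : ℝ)))
      rw [← pi_withDensity (fun _ => m) (f := fun i y =>
        ENNReal.ofReal (Real.exp (θ i * (y : ℝ)) / tiltMass (θ i) m)) fun i => by fun_prop,
        Measure.pi_pi]
      rfl
    have h3 : ∀ m : Measure Y, ∏ i, m.tilted (fun y => θ i * (y : ℝ)) (B i) =
        ∏ i, ∫⁻ y, (B i).indicator (fun y : Y => ENNReal.ofReal (Real.exp (θ i * (y : ℝ)))) y *
          ENNReal.ofReal (tiltMass (θ i) m)⁻¹ ∂m := fun m => by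
      refine Finset.prod_congr rfl fun i _ => ?_
      rw [tilted_apply' _ _ (hB i), ← lintegral_indicator (hB i)]
      refine lintegral_congr fun y => ?_
      by_cases hy : y ∈ B i
      · rw [Set.indicator_of_mem hy, Set.indicator_of_mem hy, div_eq_mul_inv,
          ENNReal.ofReal_mul (Real.exp_pos _).le]
        rfl
      · simp [Set.indicator_of_notMem hy]
    have h4 : Measurable fun m : Measure Y => ∏ i, m.tilted (fun y => θ i * (y : ℝ)) (B i) := by
      simp_rw [h3]
      refine Finset.measurable_fun_prod _ fun i _ => ?_
      have hind : Measurable ((B i).indicator fun y : Y =>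
          ENNReal.ofReal (Real.exp (θ i * (y : ℝ)))) :=
        Measurable.indicator (by fun_prop) (hB i)
      simp_rw [lintegral_mul_const _ hind]
      exact (Measure.measurable_lintegral hind).mul (by fun_prop)
    rw [h1, hz.joint A B hA hB, lintegral_congr_ae h2, Measure.restrict_map hμ hA,
      lintegral_map h4 hμ]
    rfl
  refine Measure.ext_prod fun {A C} hA hC => ?_
  have hsnd : ∀ (M : Measure (Measure Y × (Fin n → Y))) {D : Set (Fin n → Y)}, MeasurableSet D →
      ((M.restrict (A ×ˢ Set.univ)).map Prod.snd) D = M (A ×ˢ D) := fun M D hD => by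
    rw [Measure.map_apply measurable_snd hD, Measure.restrict_apply (measurable_snd hD)]
    congr 1
    ext p
    simp [and_comm]
  rw [← hsnd _ hC, ← hsnd _ hC]
  congr 1
  refine ext_of_generate_finite _ generateFrom_pi.symm isPiSystem_pi ?_ ?_
  · rintro _ ⟨B, hB, rfl⟩
    have hB : ∀ i, MeasurableSet (B i) := fun i => hB i trivial
    rw [hsnd _ (.univ_pi hB), hsnd _ (.univ_pi hB), key A B hA hB]
  · have := key A (fun _ => Set.univ) hA fun _ => MeasurableSet.univ
    rw [Set.pi_univ] at this
    rw [hsnd _ .univ, hsnd _ .univ, this]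

end Sample

/-! ### Disintegration with respect to the sample and the auxiliary variables -/

section Auxiliary

variable {Y : Set ℝ} {n : ℕ}

/-- Given `m`, the auxiliary variables `γᵢ / Tᵢ(m)` have density `∏ᵢ Tᵢ(m) exp (-uᵢ Tᵢ(m))`. -/
lemma lintegral_pi_expMeasure_div {T : Fin n → ℝ} (hT : ∀ i, 0 < T i)
    {F : (Fin n → ℝ) → ℝ≥0∞} (hF : Measurable F) :
    ∫⁻ c, F (fun i => c i / T i) ∂(Measure.pi fun _ => expMeasure 1) =
      ∫⁻ u, (∏ i, ENNReal.ofReal (T i * Real.exp (-(u i * T i)))) * F u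
        ∂(Measure.pi fun _ => volume.restrict (Set.Ioi (0 : ℝ))) := by
  have hprob : ∀ i, IsProbabilityMeasure ((expMeasure 1).map fun x => x / T i) :=
    fun i => Measure.isProbabilityMeasure_map (by fun_prop)
  have : ∀ i, IsFiniteMeasure ((volume.restrict (Set.Ioi (0 : ℝ))).withDensity
      fun u => ENNReal.ofReal (T i * Real.exp (-(u * T i)))) := fun i => by
    rw [← expMeasure_one_map_div (hT i)]
    infer_instance
  have hlaw : (Measure.pi fun _ : Fin n => expMeasure 1).map (fun c i => c i / T i) =
      (Measure.pi fun _ => volume.restrict (Set.Ioi (0 : ℝ))).withDensity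
        fun u => ∏ i, ENNReal.ofReal (T i * Real.exp (-(u i * T i))) := by
    rw [Measure.pi_map_pi (f := fun i x => x / T i) fun i => by fun_prop]
    simp_rw [expMeasure_one_map_div (hT _)]
    exact pi_withDensity (fun _ => volume.restrict (Set.Ioi (0 : ℝ)))
      (f := fun i u => ENNReal.ofReal (T i * Real.exp (-(u * T i)))) fun i => by fun_prop
  rw [← lintegral_map (f := F) (g := fun (c : Fin n → ℝ) i => c i / T i) hF (by fun_prop), hlaw,
    lintegral_withDensity_eq_lintegral_mul _ (by fun_prop) hF]
  rfl

variable {Ω : Type*} [MeasurableSpace Ω] {P : Measure Ω}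
  {θ : Fin n → ℝ} {μ : Ω → Measure Y} {z : Ω → Fin n → Y} {γ : Ω → Fin n → ℝ}

lemma aemeasurable_auxU (hμ : Measurable μ) (hγ : AEMeasurable γ P) :
    AEMeasurable (auxU θ μ γ) P := by
  refine aemeasurable_pi_lambda _ fun i => ?_
  have h1 : AEMeasurable (fun ω => γ ω i) P := (measurable_pi_apply i).comp_aemeasurable hγ
  exact h1.div ((measurable_tiltMass (θ i)).comp hμ).aemeasurable

variable [IsProbabilityMeasure P]

/-- The joint law of `(u, μ, z)`: the factors `Tᵢ` of the density of `u` given `μ` cancel the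
normalizing constants of the tilted measures, so that, with respect to
`du law(μ)(dm) m(dz₁) ⋯ m(dzₙ)`, it has the density `exp (-∫ ψ_u dm) ∏ᵢ exp (θᵢ zᵢ)`. -/
theorem lintegral_auxU_sample (hμ : Measurable μ) (hfin : ∀ᵐ m ∂(P.map μ), IsFiniteMeasure m)
    (hz : IsTiltedSample P θ μ z) (hγ : HasLaw γ (Measure.pi fun _ => expMeasure 1) P)
    (hindep : IndepFun γ (fun ω => (μ ω, z ω)) P)
    {F : (Fin n → ℝ) × (Measure Y × (Fin n → Y)) → ℝ≥0∞} (hF : Measurable F) :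
    ∫⁻ ω, F (auxU θ μ γ ω, (μ ω, z ω)) ∂P =
      ∫⁻ u, ∫⁻ m, expNeg (∫⁻ y, psiNN θ (u, y) ∂m) *
        ∫⁻ v, (∏ i, ENNReal.ofReal (Real.exp (θ i * (v i : ℝ)))) * F (u, (m, v))
          ∂(powKernel Y n m) ∂(P.map μ)
        ∂(Measure.pi fun _ => volume.restrict (Set.Ioi (0 : ℝ))) := by
  have := Measure.isProbabilityMeasure_map (μ := P) hμ.aemeasurable
  have hpair : Measurable fun ω => (μ ω, z ω) := hμ.prodMk hz.measurable
  have := Measure.isProbabilityMeasure_map (μ := P) hpair.aemeasurable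
  set Lu : Measure (Fin n → ℝ) := Measure.pi fun _ => volume.restrict (Set.Ioi (0 : ℝ))
  set S := P.map μ ⊗ₘ powKernel Y n
  have hpos : ∀ᵐ p ∂S, ∀ i, 0 < tiltMass (θ i) p.1 := by
    refine Measure.ae_compProd_of_ae_fst _ ?_ (hz.ae_tiltMass_pos hμ)
    rw [Set.ofPred_forall]
    exact MeasurableSet.iInter fun i => measurable_tiltMass (θ i) measurableSet_Ioi
  have hFdiv : Measurable fun q : (Fin n → ℝ) × (Measure Y × (Fin n → Y)) =>
      F (fun i => q.1 i / tiltMass (θ i) q.2.1, q.2) := hF.comp (by fun_prop)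
  have hD : Measurable fun p : Measure Y × (Fin n → Y) =>
      ∏ i, ENNReal.ofReal (Real.exp (θ i * (p.2 i : ℝ)) / tiltMass (θ i) p.1) := by fun_prop
  have hdens : Measurable fun q : (Measure Y × (Fin n → Y)) × (Fin n → ℝ) =>
      (∏ i, ENNReal.ofReal (Real.exp (θ i * (q.1.2 i : ℝ)) / tiltMass (θ i) q.1.1)) *
        ((∏ i, ENNReal.ofReal (tiltMass (θ i) q.1.1 *
          Real.exp (-(q.2 i * tiltMass (θ i) q.1.1)))) * F (q.2, q.1)) := by
    have : Measurable fun q : (Measure Y × (Fin n → Y)) × (Fin n → ℝ) => F (q.2, q.1) :=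
      hF.comp measurable_swap
    fun_prop
  calc ∫⁻ ω, F (auxU θ μ γ ω, (μ ω, z ω)) ∂P
      = ∫⁻ q, F (fun i => q.1 i / tiltMass (θ i) q.2.1, q.2)
          ∂(P.map fun ω => (γ ω, (μ ω, z ω))) := by
        rw [lintegral_map' hFdiv.aemeasurable (hγ.aemeasurable.prodMk hpair.aemeasurable)]
        rfl
    _ = ∫⁻ p, ∫⁻ c, F (fun i => c i / tiltMass (θ i) p.1, p)
          ∂(Measure.pi fun _ => expMeasure 1) ∂(P.map fun ω => (μ ω, z ω)) := by
        rw [(indepFun_iff_map_prod_eq_prod_map_map hγ.aemeasurable hpair.aemeasurable).1 hindep,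
          hγ.map_eq, lintegral_prod_symm' _ hFdiv]
    _ = ∫⁻ p, (∏ i, ENNReal.ofReal (Real.exp (θ i * (p.2 i : ℝ)) / tiltMass (θ i) p.1)) *
          ∫⁻ c, F (fun i => c i / tiltMass (θ i) p.1, p)
            ∂(Measure.pi fun _ => expMeasure 1) ∂S := by
        rw [hz.map_eq hμ hfin, lintegral_withDensity_eq_lintegral_mul _ hD
          hFdiv.lintegral_prod_left']
        rfl
    _ = ∫⁻ p, ∫⁻ u, (∏ i, ENNReal.ofReal (Real.exp (θ i * (p.2 i : ℝ)) / tiltMass (θ i) p.1)) *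
          ((∏ i, ENNReal.ofReal (tiltMass (θ i) p.1 * Real.exp (-(u i * tiltMass (θ i) p.1)))) *
            F (u, p)) ∂Lu ∂S := by
        refine lintegral_congr_ae ?_
        filter_upwards [hpos] with p hp
        rw [lintegral_pi_expMeasure_div (T := fun i => tiltMass (θ i) p.1) hp
          (F := fun u => F (u, p)) (by fun_prop), lintegral_const_mul]
        have : Measurable fun u => F (u, p) := by fun_prop
        fun_prop
    _ = ∫⁻ u, ∫⁻ p, (∏ i, ENNReal.ofReal (Real.exp (θ i * (p.2 i : ℝ)) / tiltMass (θ i) p.1)) *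
          ((∏ i, ENNReal.ofReal (tiltMass (θ i) p.1 * Real.exp (-(u i * tiltMass (θ i) p.1)))) *
            F (u, p)) ∂S ∂Lu :=
        lintegral_lintegral_swap hdens.aemeasurable
    _ = _ := by
        have hupos : ∀ᵐ u ∂Lu, ∀ i, 0 < u i := ae_all_iff.2 fun i =>
          (Measure.quasiMeasurePreserving_eval
            (fun _ : Fin n => volume.restrict (Set.Ioi (0 : ℝ))) i).ae
              (ae_restrict_mem measurableSet_Ioi)
        refine lintegral_congr_ae ?_
        filter_upwards [hupos] with u hu
        have hFu : Measurable fun p => F (u, p) := by fun_prop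
        have he := measurable_expNeg_lintegral (g := fun y : Y => psiNN θ (u, y)) (by fun_prop)
        rw [lintegral_congr_ae (g := fun p => expNeg (∫⁻ y, psiNN θ (u, y) ∂p.1) *
          ((∏ i, ENNReal.ofReal (Real.exp (θ i * (p.2 i : ℝ)))) * F (u, p))),
          Measure.lintegral_compProd (by fun_prop)]
        · refine lintegral_congr fun m => ?_
          have : Measurable fun v : Fin n → Y =>
              (∏ i, ENNReal.ofReal (Real.exp (θ i * (v i : ℝ)))) * F (u, (m, v)) := by fun_prop
          exact lintegral_const_mul (expNeg (∫⁻ y, psiNN θ (u, y) ∂m)) this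
        · filter_upwards [hpos] with p hp
          rw [expNeg_lintegral_psiNN θ (fun i => (hu i).le) hp, ← mul_assoc, ← mul_assoc,
            ← Finset.prod_mul_distrib, ← Finset.prod_mul_distrib]
          congr 1
          refine Finset.prod_congr rfl fun i _ => ?_
          have := hp i
          rw [← ENNReal.ofReal_mul (by positivity), ← ENNReal.ofReal_mul (by positivity)]
          congr 1
          field_simp

/-- Laplace form of the disintegration: on every event `{(u, z) ∈ C}`, the random measure `μ` has
the same Laplace functional as the mixture of the posterior laws. -/
theorem lintegral_indicator_mul_expNeg_eq {α : ℝ} (hα : 0 < α) {G₀ : Measure Y}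
    [IsProbabilityMeasure G₀] (hμ : Measurable μ) (hCRM : IsCRM (P.map μ) (gammaLevy α G₀))
    (hz : IsTiltedSample P θ μ z) (hγ : HasLaw γ (Measure.pi fun _ => expMeasure 1) P)
    (hindep : IndepFun γ (fun ω => (μ ω, z ω)) P)
    {C : Set ((Fin n → ℝ) × (Fin n → Y))} (hC : MeasurableSet C) {g : Y → ℝ≥0}
    (hg : Measurable g) :
    ∫⁻ ω, C.indicator 1 (auxU θ μ γ ω, z ω) * expNeg (∫⁻ y, g y ∂(μ ω)) ∂P =
      ∫⁻ ω, C.indicator 1 (auxU θ μ γ ω, z ω) * ∫⁻ m, expNeg (∫⁻ y, g y ∂m)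
        ∂(posteriorKernel (P.map μ) (psiNN θ) n (auxU θ μ γ ω, z ω)) ∂P := by
  have := Measure.isProbabilityMeasure_map (μ := P) hμ.aemeasurable
  have hfin := hCRM.ae_isFiniteMeasure hα
  have hind : Measurable fun q : (Fin n → ℝ) × (Measure Y × (Fin n → Y)) =>
      (C.indicator 1 (q.1, q.2.2) : ℝ≥0∞) :=
    (measurable_one.indicator hC).comp (by fun_prop)
  have hgm := measurable_expNeg_lintegral hg
  have hker : Measurable fun q : (Fin n → ℝ) × (Measure Y × (Fin n → Y)) =>
      ∫⁻ m, expNeg (∫⁻ y, g y ∂m) ∂(posteriorKernel (P.map μ) (psiNN θ) n (q.1, q.2.2)) :=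
    ((Measure.measurable_lintegral hgm).comp (Kernel.measurable _)).comp (by fun_prop)
  rw [lintegral_auxU_sample hμ hfin hz hγ hindep
      (F := fun q => C.indicator 1 (q.1, q.2.2) * expNeg (∫⁻ y, g y ∂q.2.1)) (by fun_prop),
    lintegral_auxU_sample hμ hfin hz hγ hindep
      (F := fun q => C.indicator 1 (q.1, q.2.2) * ∫⁻ m, expNeg (∫⁻ y, g y ∂m)
        ∂(posteriorKernel (P.map μ) (psiNN θ) n (q.1, q.2.2))) (by fun_prop)]
  refine lintegral_congr fun u => ?_
  have hψ : Measurable fun y : Y => psiNN θ (u, y) := by fun_prop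
  have hW : Measurable fun v : Fin n → Y =>
      (∏ i, ENNReal.ofReal (Real.exp (θ i * (v i : ℝ)))) * C.indicator 1 (u, v) :=
    Measurable.mul (by fun_prop) ((measurable_one.indicator hC).comp (by fun_prop))
  have hkeru : Measurable fun v : Fin n → Y => ∫⁻ m, expNeg (∫⁻ y, g y ∂m)
      ∂(posteriorKernel (P.map μ) (psiNN θ) n (u, v)) :=
    ((Measure.measurable_lintegral hgm).comp (Kernel.measurable _)).comp (by fun_prop)
  calc _ = ∫⁻ m, expNeg (∫⁻ y, (psiNN θ (u, y) + g y : ℝ≥0) ∂m) *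
          ∫⁻ v, (∏ i, ENNReal.ofReal (Real.exp (θ i * (v i : ℝ)))) * C.indicator 1 (u, v)
            ∂(powKernel Y n m) ∂(P.map μ) := by
        refine lintegral_congr fun m => ?_
        simp_rw [← mul_assoc]
        rw [lintegral_mul_const _ hW]
        simp_rw [ENNReal.coe_add]
        rw [lintegral_add_left hψ.coe_nnreal_ennreal, expNeg_add]
        ring
    _ = expNeg (levyExponent (gammaLevy α G₀) fun y => psiNN θ (u, y)) *
          ∫⁻ m, ∫⁻ v, (∏ i, (((1 + psiNN θ (u, v i))⁻¹ : ℝ≥0) : ℝ≥0∞)) *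
            ((∏ i, ENNReal.ofReal (Real.exp (θ i * (v i : ℝ)))) *
              (C.indicator 1 (u, v) * ∫⁻ m, expNeg (∫⁻ y, g y ∂m)
                ∂(posteriorKernel (P.map μ) (psiNN θ) n (u, v))))
            ∂(powKernel Y n m) ∂(P.map μ) := by
        rw [lintegral_expNeg_mul_powKernel hα hCRM (by fun_prop) hW,
          levyExponent_gammaLevy_add hψ hg, expNeg_add, mul_assoc]
        congr 1
        rw [← lintegral_const_mul']
        · refine lintegral_congr fun m => ?_
          rw [← lintegral_const_mul']
          · refine lintegral_congr fun v => ?_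
            rw [lintegral_expNeg_posteriorKernel hα hCRM (by fun_prop) u v hg]
            -- `1 / (1 + ψ + g) = 1 / (1 + ψ) * ((1 + ψ) / (1 + ψ + g))`: the second factor is the
            -- Laplace transform of an exponential atom of rate `1 + ψ`.
            have hprod : (∏ i, (((1 + (psiNN θ (u, v i) + g (v i)))⁻¹ : ℝ≥0) : ℝ≥0∞)) =
                (∏ i, (((1 + psiNN θ (u, v i))⁻¹ : ℝ≥0) : ℝ≥0∞)) *
                  ∏ i, (((1 + psiNN θ (u, v i)) / (1 + psiNN θ (u, v i) + g (v i)) : ℝ≥0) :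
                    ℝ≥0∞) := by
              rw [← Finset.prod_mul_distrib]
              refine Finset.prod_congr rfl fun i _ => ?_
              rw [← ENNReal.coe_mul]
              congr 1
              have h1 : 1 + psiNN θ (u, v i) ≠ 0 := by positivity
              rw [div_eq_mul_inv, inv_mul_cancel_left₀ h1, add_assoc]
            rw [hprod]
            ring
          · exact ne_top_of_le_ne_top ENNReal.one_ne_top (expNeg_le_one _)
        · exact ne_top_of_le_ne_top ENNReal.one_ne_top (expNeg_le_one _)
    _ = _ := by
        rw [← lintegral_expNeg_mul_powKernel hα hCRM hψ]
        simp_rw [← mul_assoc]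
        exact hW.mul hkeru

/-- The posterior kernel is a conditional distribution of `μ` given `(u, z)`. -/
theorem hasCondDistrib_posteriorKernel {α : ℝ} (hα : 0 < α) {G₀ : Measure Y}
    [IsProbabilityMeasure G₀] (hμ : Measurable μ) (hCRM : IsCRM (P.map μ) (gammaLevy α G₀))
    (hz : IsTiltedSample P θ μ z) (hγ : HasLaw γ (Measure.pi fun _ => expMeasure 1) P)
    (hindep : IndepFun γ (fun ω => (μ ω, z ω)) P) :
    HasCondDistrib μ (fun ω => (auxU θ μ γ ω, z ω))
      (posteriorKernel (P.map μ) (psiNN θ) n) P := by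
  have hQ := Measure.isProbabilityMeasure_map (μ := P) hμ.aemeasurable
  have hκ := isMarkovKernel_posteriorKernel (Q := P.map μ) (n := n) (measurable_psiNN (Y := Y) θ)
  have hX : AEMeasurable (fun ω => (auxU θ μ γ ω, z ω)) P :=
    (aemeasurable_auxU hμ hγ.aemeasurable).prodMk hz.measurable.aemeasurable
  have := Measure.isProbabilityMeasure_map hX
  have hXμ : AEMeasurable (fun ω => ((auxU θ μ γ ω, z ω), μ ω)) P := hX.prodMk hμ.aemeasurable
  have := Measure.isProbabilityMeasure_map hXμ
  refine ⟨hXμ, Measure.ext_prod fun {C A} hC hA => ?_⟩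
  -- `N M` is the second marginal of `M` on the event that the first coordinate lies in `C`.
  let N : Measure (((Fin n → ℝ) × (Fin n → Y)) × Measure Y) → Measure (Measure Y) :=
    fun M => (M.restrict (C ×ˢ Set.univ)).map Prod.snd
  have hCuniv : MeasurableSet (C ×ˢ (Set.univ : Set (Measure Y))) := hC.prod .univ
  have hN : ∀ M, N M A = M (C ×ˢ A) := fun M => by
    rw [Measure.map_apply measurable_snd hA, Measure.restrict_apply (measurable_snd hA)]
    congr 1
    ext p
    simp [and_comm]
  have hNint : ∀ (M) {f : Measure Y → ℝ≥0∞}, Measurable f →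
      ∫⁻ m, f m ∂(N M) = ∫⁻ p, C.indicator 1 p.1 * f p.2 ∂M := fun M f hf => by
    rw [lintegral_map hf measurable_snd, ← lintegral_indicator hCuniv]
    refine lintegral_congr fun p => ?_
    by_cases hp : p.1 ∈ C <;> simp [hp, Set.indicator]
  rw [← hN, ← hN]
  congr 1
  have hfinN : ∀ M, (∀ᵐ p ∂M, IsFiniteMeasure p.2) → ∀ᵐ m ∂(N M), IsFiniteMeasure m :=
    fun M hM => (ae_map_iff measurable_snd.aemeasurable measurableSet_isFiniteMeasure).2
      (ae_restrict_of_ae hM)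
  refine Measure.ext_of_laplaceFunctional (hfinN _ ?_) (hfinN _ ?_) fun g hg => ?_
  · refine (ae_map_iff hXμ (p := fun p => IsFiniteMeasure p.2)
      (measurable_snd measurableSet_isFiniteMeasure)).2 ?_
    have := hCRM.ae_isFiniteMeasure hα
    rwa [ae_map_iff hμ.aemeasurable measurableSet_isFiniteMeasure] at this
  · exact Measure.ae_compProd_of_ae_ae (measurable_snd measurableSet_isFiniteMeasure)
      (ae_of_all _ fun x => ae_isFiniteMeasure_posteriorKernel (by fun_prop) x)
  · have hgm := measurable_expNeg_lintegral hg
    have hCm : Measurable (C.indicator (1 : (Fin n → ℝ) × (Fin n → Y) → ℝ≥0∞)) :=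
      measurable_one.indicator hC
    rw [hNint _ hgm, hNint _ hgm, lintegral_map' (by fun_prop) hXμ,
      Measure.lintegral_compProd (by fun_prop)]
    simp_rw [lintegral_const_mul _ hgm]
    rw [lintegral_map' _ hX]
    · exact lintegral_indicator_mul_expNeg_eq hα hμ hCRM hz hγ hindep hC hg
    · exact (hCm.mul ((Measure.measurable_lintegral hgm).comp (Kernel.measurable _))).aemeasurable

end Auxiliary

theorem proposition3 {Ω : Type*} [MeasurableSpace Ω] (P : Measure Ω) [IsProbabilityMeasure P]
    (Y : Set ℝ) (hY : MeasurableSet Y) (α : ℝ) (hα : 0 < α)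
    (G₀ : Measure Y) [IsProbabilityMeasure G₀]
    (n : ℕ) (θ : Fin n → ℝ)
    (μ : Ω → Measure Y) (hμ : Measurable μ) (hCRM : IsCRM (P.map μ) (gammaLevy α G₀))
    (z : Ω → Fin n → Y) (hz : IsTiltedSample P θ μ z)
    (γ : Ω → Fin n → ℝ) (hγ : HasLaw γ (Measure.pi fun _ => expMeasure 1) P)
    (hγ_indep : IndepFun γ (fun ω => (μ ω, z ω)) P) :
    ∃ κ : Kernel ((Fin n → ℝ) × (Fin n → Y)) (Measure Y),
      IsMarkovKernel κ ∧
      HasCondDistrib μ (fun ω => (auxU θ μ γ ω, z ω)) κ P ∧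
      ∀ u : Fin n → ℝ, (∀ i, 0 < u i) → ∃ Q : Measure (Measure Y),
        IsCRM Q (inhomLevy α G₀ (psi u θ)) ∧
        ∀ (v : Fin n → Y) (k : ℕ) (zs : Fin k → Y),
          Function.Injective zs → Set.range zs = Set.range v →
          κ (u, v) =
            (Q.prod (Measure.pi fun l => gammaMeasure (numTies v (zs l)) (psi u θ (zs l) + 1))).map
              (fun p => p.1 + ∑ l, ENNReal.ofReal (p.2 l) • Measure.dirac (zs l)) ∧
          (∀ᵐ m ∂(κ (u, v)), ∀ l, 0 < m {zs l}) ∧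
          ((∀ l, G₀ {zs l} = 0) →
            (κ (u, v)).map (fun m => (m.restrict (Set.range zs)ᶜ, fun l => (m {zs l}).toReal)) =
              Q.prod
                (Measure.pi fun l => gammaMeasure (numTies v (zs l)) (psi u θ (zs l) + 1))) := by
  have hQ := Measure.isProbabilityMeasure_map (μ := P) hμ.aemeasurable
  have hψ := measurable_psiNN (Y := Y) θ
  refine ⟨posteriorKernel (P.map μ) (psiNN θ) n, isMarkovKernel_posteriorKernel hψ,
    hasCondDistrib_posteriorKernel hα hμ hCRM hz hγ hγ_indep, fun u hu =>
    ⟨(P.map μ).map (divOneAdd fun y => psiNN θ (u, y)), ?_, ?_⟩⟩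
  · have := isCRM_map_divOneAdd hα hCRM (h := fun y => psiNN θ (u, y)) (by fun_prop)
    simpa only [coe_psiNN θ fun i => (hu i).le] using this
  intro v k zs hinj hrange
  have hcrm := isCRM_map_divOneAdd hα hCRM (h := fun y => psiNN θ (u, y)) (by fun_prop)
  have := hcrm.isProbabilityMeasure
  have hprob : ∀ l, IsProbabilityMeasure
      (gammaMeasure (numTies v (zs l)) (psiNN θ (u, zs l) + 1)) := fun l =>
    isProbabilityMeasure_gammaMeasure (by exact_mod_cast numTies_pos hrange l) (by positivity)
  simp_rw [← coe_psiNN θ fun i => (hu i).le]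
  rw [posteriorKernel_eq_map_addAtoms hα hCRM hψ u v hinj hrange]
  exact ⟨rfl, ae_pos_map_addAtoms hinj fun l => ae_pos_gammaMeasure _ _, fun hG =>
    map_restrict_map_addAtoms hinj (fun l => ae_pos_gammaMeasure _ _) fun l =>
      ae_measure_singleton_eq_zero (by fun_prop) hcrm (hG l)⟩
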